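/- Let $A$ be a commutative $\mathbb{Q}$-algebra of functions of the times $t=(t_1=x,t_3,t_5,\dots)$, that is, $A$ carries commuting derivations $\partial_{2n+1}=\partial/\partial t_{2n+1}$ ($n\ge 0$); put $\partial=\partial_1=\partial/\partial x$. Write $\xi(t,\lambda)=\sum_{n\ge0}t_{2n+1}\lambda^{2n+1}$, $[\lambda^{-1}]=(\lambda^{-1},\tfrac13\lambda^{-3},\tfrac15\lambda^{-5},\dots)$ and $f(t\pm2[\lambda^{-1}])=\exp\big(\pm\sum_{n\ge0}\tfrac{2}{2n+1}\lambda^{-(2n+1)}\partial_{2n+1}\big)f(t)$. Let $W=1+\sum_{j\ge1}w_j\partial^{-j}$, with $w_j\in A$, be a dressing operator of the BKP hierarchy: with $L=W\partial W^{-1}$, $$\partial_{2n+1}W=-(L^{2n+1})_-W\quad(n=0,1,2,\dots),\qquad W^*\partial W=\partial .$$ Let $\psi_{BA}(t,\lambda)=W(e^{\xi(t,\lambda)})=w(t,\lambda)e^{\xi(t,\lambda)}$, $w(t,\lambda)=1+\sum_{j\ge1}w_j\lambda^{-j}$, be its wave function, and let $\tau\in A$ be invertible with $w(t,\lambda)=\tau(t-2[\lambda^{-1}])/\tau(t)$.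 Let $$\mathcal X(\lambda,\mu)=e^{\xi(t+2[\lambda^{-1}],\mu)-\xi(t,\lambda)}\exp\Big(\sum_{l\ge1}\tfrac{2}{2l-1}\big(\lambda^{-(2l-1)}-\mu^{-(2l-1)}\big)\frac{\partial}{\partial t_{2l-1}}\Big)$$ be the BKP vertex operator. Its action $\mathcal X(\lambda,\mu)\psi_{BA}(t,z)$ on the wave function is, by definition, the infinitesimal change of $\psi_{BA}(t,z)=\frac{\tau(t-2[z^{-1}])}{\tau(t)}e^{\xi(t,z)}$ induced by the infinitesimal change $\delta\tau=\mathcal X(\lambda,\mu)\tau$ of $\tau$: $$\mathcal X(\lambda,\mu)\psi_{BA}(t,z)=\frac{\delta\tau(t-2[z^{-1}])\,\tau(t)-\tau(t-2[z^{-1}])\,\delta\tau(t)}{\tau(t)^2}\,e^{\xi(t,z)} .$$ Let $Y(\lambda,\mu)$ be the pseudodifferential operator $$Y(\lambda,\mu)=\psi_{BA}(t,-\lambda)\,\partial^{-1}\,\psi_{BA}(t,\mu)_x-\psi_{BA}(t,\mu)\,\partial^{-1}\,\psi_{BA}(t,-\lambda)_x ,$$ acting by $Y(\lambda,\mu)\psi_{BA}(t,z)=(Y(\lambda,\mu)W)(e^{\xi(t,z)})$,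 where $\partial^{-k}(e^{\xi(t,z)})=z^{-k}e^{\xi(t,z)}$. Then, with $\Delta_zf(t)=f(t-2[z^{-1}])-f(t)$ and as formal series expanded in $|z|>|\lambda|>|\mu|$, one has the Adler–Shiota–van Moerbeke formula $$\mathcal X(\lambda,\mu)\psi_{BA}(t,z)=\psi_{BA}(t,z)\,\Delta_z\frac{\mathcal X(\lambda,\mu)\tau(t)}{\tau(t)}=2\,Y(\lambda,\mu)\psi_{BA}(t,z).$$ -/

import Mathlib

noncomputable section

namespace BKP

open LaurentPolynomial

/-! ### Algebras of functions of the times `t = (t₁ = x, t₃, t₅, …)` -/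

/-- A commutative `ℚ`-algebra of functions of the times `t = (t₁ = x, t₃, t₅, …)`, for instance formal
power series, rational functions, or smooth, analytic or meromorphic functions: it carries commuting
derivations `∂ n = ∂/∂t_{2n+1}`. In particular `∂ 0 = ∂/∂x`. -/
class TimeAlgebra (R : Type*) [CommRing R] [Algebra ℚ R] where
  /-- the derivation `∂/∂t_{2n+1}` -/
  pd : ℕ → Derivation ℚ R R
  pd_comm : ∀ (m n : ℕ) (f : R), pd m (pd n f) = pd n (pd m f)

open TimeAlgebra

/-! Formal Laurent series in `λ⁻¹`: the coefficient of index `n` is the coefficient of `λ⁻ⁿ`.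
Time derivatives act coefficientwise. -/

/-- The coefficientwise `ℚ`-algebra structure. -/
instance instAlgebraLaurent (R : Type*) [CommRing R] [Algebra ℚ R] :
    Algebra ℚ (LaurentSeries R) := HahnSeries.instAlgebra

/-- A derivation applied to the coefficients of a Laurent series. -/
def laurentDer {R : Type*} [CommRing R] [Algebra ℚ R] (d : Derivation ℚ R R) :
    Derivation ℚ (LaurentSeries R) (LaurentSeries R) :=
  Derivation.mk'
    { toFun := fun f => f.map d
      map_add' := fun f g => by ext n; simp
      map_smul' := fun c f => by ext n; simp }
    (fun f g => by
      ext n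
      have h1 : (f.map d).support ⊆ f.support := by
        intro i hi hf
        exact hi (by simp [hf])
      have h2 : (g.map d).support ⊆ g.support := by
        intro i hi hf
        exact hi (by simp [hf])
      simp only [LinearMap.coe_mk, AddHom.coe_mk, smul_eq_mul, HahnSeries.map_coeff,
        HahnSeries.coeff_add]
      rw [HahnSeries.coeff_mul, HahnSeries.coeff_mul_right' g.isPWO_support h2, mul_comm g,
        HahnSeries.coeff_mul_left' f.isPWO_support h1, map_sum, ← Finset.sum_add_distrib]
      refine Finset.sum_congr rfl fun ij _ => ?_
      simp only [Derivation.leibniz, smul_eq_mul, HahnSeries.map_coeff]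
      ring)

instance instTimeAlgebraLaurent (R : Type*) [CommRing R] [Algebra ℚ R] [TimeAlgebra R] :
    TimeAlgebra (LaurentSeries R) where
  pd n := laurentDer (pd n)
  pd_comm m n f := by
    ext i
    exact pd_comm m n (f.coeff i)

/-- The spectral parameter `λ`, as an element of `R((λ⁻¹))`. -/
def spec (R : Type*) [CommRing R] : LaurentSeries R := HahnSeries.single (-1) 1

/-- The additive map underlying `expDer`: `a e^k ↦ (d a + k c a) e^k`. -/
def expDerHom {S : Type*} [CommRing S] [Algebra ℚ S] (d : Derivation ℚ S S) (c : S) :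
    S[T;T⁻¹] →+ S[T;T⁻¹] where
  toFun f := f.coeff.sum fun k a => C (d a + k * c * a) * T k
  map_zero' := by simp
  map_add' f g := by
    rw [AddMonoidAlgebra.coeff_add]
    refine Finsupp.sum_add_index' (fun k => by simp) ?_
    intro k a b
    rw [← add_mul, ← map_add]
    congr 2
    rw [map_add]
    ring

theorem expDerHom_C_mul_T {S : Type*} [CommRing S] [Algebra ℚ S] (d : Derivation ℚ S S) (c : S)
    (k : ℤ) (a : S) : expDerHom d c (C a * T k) = C (d a + k * c * a) * T k := by
  rw [← single_eq_C_mul_T]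
  change Finsupp.sum (Finsupp.single k a) (fun k a => C (d a + k * c * a) * T k) = _
  rw [Finsupp.sum_single_index (by simp)]

/-- The derivation `d` of `S`, extended to `S[e, e⁻¹]` by the rule `d e = c e`. -/
def expDer {S : Type*} [CommRing S] [Algebra ℚ S] (d : Derivation ℚ S S) (c : S) :
    Derivation ℚ S[T;T⁻¹] S[T;T⁻¹] :=
  Derivation.mk' (expDerHom d c).toRatLinearMap (fun f g => by
    change expDerHom d c (f * g) = f * expDerHom d c g + g * expDerHom d c f
    induction f using LaurentPolynomial.induction_on' with
    | add p q hp hq => rw [add_mul, map_add, hp, hq, map_add]; ring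
    | C_mul_T k a =>
      induction g using LaurentPolynomial.induction_on' with
      | add p q hp hq => rw [mul_add, map_add, hp, hq, map_add]; ring
      | C_mul_T l b =>
        have h : (C a * T k : S[T;T⁻¹]) * (C b * T l) = C (a * b) * T (k + l) := by
          rw [map_mul, T_add]; ring
        rw [h, expDerHom_C_mul_T, expDerHom_C_mul_T, expDerHom_C_mul_T, T_add]
        simp only [Derivation.leibniz, smul_eq_mul, map_add, map_mul]
        push_cast
        simp only [map_add]
        ring)

theorem expDer_C_mul_T {S : Type*} [CommRing S] [Algebra ℚ S] (d : Derivation ℚ S S) (c : S)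
    (k : ℤ) (a : S) : expDer d c (C a * T k) = C (d a + k * c * a) * T k :=
  expDerHom_C_mul_T d c k a

/-- `R((λ⁻¹))[e^{ξ(t,λ)}, e^{-ξ(t,λ)}]`, where `ξ(t,λ) = ∑ t_{2n+1} λ^{2n+1}`: the ring in which formal
Baker-Akhiezer functions with spectral parameter `λ` live. Here `e^{kξ(t,λ)}` is written `T k`. -/
abbrev BA (R : Type*) [CommRing R] : Type _ := (LaurentSeries R)[T;T⁻¹]

/-- The time derivatives on `BA R`, determined by
`∂/∂t_{2n+1} e^{ξ(t,λ)} = λ^{2n+1} e^{ξ(t,λ)}`. -/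
instance instTimeAlgebraBA (R : Type*) [CommRing R] [Algebra ℚ R] [TimeAlgebra R] :
    TimeAlgebra (BA R) where
  pd n := expDer (pd n) (spec R ^ (2 * n + 1))
  pd_comm m n f := by
    have hs : ∀ i j : ℕ, pd i (spec R ^ j) = 0 := by
      intro i j
      rw [Derivation.leibniz_pow]
      have : pd i (spec R) = 0 := by
        ext l
        change pd i ((spec R).coeff l) = 0
        by_cases hl : l = -1 <;> simp [spec, hl]
      simp [this]
    induction f using LaurentPolynomial.induction_on' with
    | add p q hp hq => simp only [map_add, hp, hq]
    | C_mul_T k a =>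
      simp only [expDer_C_mul_T]
      congr 2
      simp only [map_add, Derivation.leibniz, hs, pd_comm m n a, smul_eq_mul,
        Derivation.map_intCast, mul_zero, add_zero]
      ring

/-- Functions that do not depend on the spectral parameter, inside `BA R`. -/
def const {R : Type*} [CommRing R] : R →+* BA R :=
  (LaurentPolynomial.C).comp HahnSeries.C

/-! ### Shifts of the times -/

section Shift

variable {R : Type*} [CommRing R] [Algebra ℚ R] [TimeAlgebra R]

/-- The operator `∑_{n ≥ 0} c/(2n+1) z^{-(2n+1)} ∂/∂t_{2n+1}` on formal power series in `z⁻¹`. -/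
def shiftGen (c : ℚ) (g : PowerSeries R) : PowerSeries R :=
  PowerSeries.mk fun k => ∑ n ∈ (Finset.range k).filter (fun n => 2 * n + 1 ≤ k),
    (c / (2 * n + 1)) • pd n (PowerSeries.coeff (k - (2 * n + 1)) g)

/-- `f(t + c[z⁻¹]) = exp (∑_{n ≥ 0} c/(2n+1) z^{-(2n+1)} ∂/∂t_{2n+1}) f(t)`, as a formal series
in `z⁻¹`. The `m`-th power of the exponent contributes only to `z⁻ᵏ` with `k ≥ m`. -/
def shift (c : ℚ) (f : R) : LaurentSeries R :=
  HahnSeries.ofPowerSeries ℤ R (PowerSeries.mk fun k => ∑ m ∈ Finset.range (k + 1),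
    ((1 : ℚ) / m.factorial) •
      PowerSeries.coeff k ((shiftGen c)^[m] (PowerSeries.C f)))

/-- The shift-difference operator `Δ_z f = f(t - 2[z⁻¹]) - f(t)`. -/
def shiftDiff (f : R) : LaurentSeries R := shift (-2) f - HahnSeries.C f

end Shift

/-! ### Pseudodifferential operators -/

/-- Pseudodifferential operators `∑_{i ≤ N} a_i ∂^i`, represented by their symbols `∑_{i ≤ N} a_i z^i`.
The coefficient of index `n` is the coefficient of `∂^{-n}`. Operator composition is `PDO.comp`;
the product `*` is the product of symbols. -/
abbrev PDO (R : Type*) [CommRing R] : Type _ := LaurentSeries R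

namespace PDO

/-- The operator `∂^m`. -/
def der (R : Type*) [CommRing R] (m : ℤ) : PDO R := HahnSeries.single (-m) 1

/-- The operator of multiplication by `f`. -/
def mulBy {R : Type*} [CommRing R] (f : R) : PDO R := HahnSeries.C f

/-- The part `P₋ = ∑_{i < 0} a_i ∂^i`. -/
def minus {R : Type*} [CommRing R] (P : PDO R) : PDO R := P - HahnSeries.truncLT 1 P

section

variable {R : Type*} [CommRing R] [Algebra ℚ R] [TimeAlgebra R]

/-- The coefficient of `∂^{-n}` in `P ∘ Q`, where `∂^i ∘ b = ∑_{k ≥ 0} (i choose k) b^{(k)} ∂^{i-k}`. -/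
def compCoeff (P Q : PDO R) (n : ℤ) : R :=
  ∑ᶠ (ik : ℤ × ℕ), P.coeff ik.1 *
    (Ring.choose (-ik.1) ik.2 • (⇑(pd 0 : Derivation ℚ R R))^[ik.2] (Q.coeff (n - ik.1 - ik.2)))

theorem compCoeff_bddBelow (P Q : PDO R) : BddBelow (Function.support (compCoeff P Q)) := by
  refine ⟨P.order + Q.order, fun n hn => ?_⟩
  by_contra hlt
  apply hn
  refine finsum_eq_zero_of_forall_eq_zero fun ik => ?_
  by_cases h : ik.1 < P.order
  · rw [HahnSeries.coeff_eq_zero_of_lt_order h, zero_mul]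
  · rw [HahnSeries.coeff_eq_zero_of_lt_order (x := Q) (by omega),
      iterate_map_zero, smul_zero, mul_zero]

/-- The sum in `compCoeff` has finitely many nonzero terms. -/
theorem compCoeff_finite (P Q : PDO R) (n : ℤ) : (Function.support fun ik : ℤ × ℕ =>
    P.coeff ik.1 * (Ring.choose (-ik.1) ik.2 •
      (⇑(pd 0 : Derivation ℚ R R))^[ik.2] (Q.coeff (n - ik.1 - ik.2)))).Finite := by
  refine Set.Finite.subset ((Set.finite_Icc P.order (n - Q.order)).prod
    (Set.finite_Iic (n - Q.order - P.order).toNat)) fun ik hik => ?_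
  by_contra hc
  apply hik
  by_cases h : ik.1 < P.order
  · simp only [HahnSeries.coeff_eq_zero_of_lt_order h, zero_mul]
  · have : n - ik.1 - ik.2 < Q.order := by
      simp only [Set.mem_prod, Set.mem_Icc, Set.mem_Iic] at hc
      omega
    simp only [HahnSeries.coeff_eq_zero_of_lt_order this, iterate_map_zero, smul_zero, mul_zero]

/-- Composition of pseudodifferential operators. -/
def comp (P Q : PDO R) : PDO R :=
  HahnSeries.ofSuppBddBelow (compCoeff P Q) (compCoeff_bddBelow P Q)

/-- Powers with respect to composition. -/
def pow (P : PDO R) : ℕ → PDO R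
  | 0 => der R 0
  | k + 1 => comp P (pow P k)

/-- The coefficient of `∂^{-n}` in the formal adjoint `P^* = ∑ (-∂)^i ∘ a_i`. -/
def adjCoeff (P : PDO R) (n : ℤ) : R :=
  ∑ᶠ k : ℕ, ((n - k).negOnePow : ℤ) •
    (Ring.choose (-(n - k)) k • (⇑(pd 0 : Derivation ℚ R R))^[k] (P.coeff (n - k)))

theorem adjCoeff_bddBelow (P : PDO R) : BddBelow (Function.support (adjCoeff P)) := by
  refine ⟨P.order, fun n hn => ?_⟩
  by_contra hlt
  apply hn
  refine finsum_eq_zero_of_forall_eq_zero fun k => ?_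
  rw [HahnSeries.coeff_eq_zero_of_lt_order (by omega), iterate_map_zero, smul_zero, smul_zero]

/-- The formal adjoint. -/
def adj (P : PDO R) : PDO R :=
  HahnSeries.ofSuppBddBelow (adjCoeff P) (adjCoeff_bddBelow P)

end

end PDO

/-! ### The BKP hierarchy, its wave function and its tau function -/

/-- `W = 1 + ∑_{j ≥ 1} w_j ∂^{-j}` is a dressing operator of the BKP hierarchy with Lax operator `L`:
`L = W ∂ W⁻¹`, Sato's equations `∂W/∂t_{2n+1} = -(L^{2n+1})₋ W` and the constraint `W^* ∂ W = ∂`. -/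
structure IsDressing {A : Type*} [CommRing A] [Algebra ℚ A] [TimeAlgebra A] (L W : PDO A) :
    Prop where
  coeff_zero : W.coeff 0 = 1
  coeff_neg : ∀ n < 0, W.coeff n = 0
  lax : PDO.comp L W = PDO.comp W (PDO.der A 1)
  sato : ∀ n : ℕ, pd n W = -PDO.comp (PDO.minus (PDO.pow L (2 * n + 1))) W
  constraint : PDO.comp (PDO.comp (PDO.adj W) (PDO.der A 1)) W = PDO.der A 1

/-- `τ` is a tau function of the hierarchy with dressing operator `W`:
`1 + ∑ w_j(t) λ^{-j} = τ(t - 2[λ⁻¹]) / τ(t)`. -/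
def IsTau {A : Type*} [CommRing A] [Algebra ℚ A] [TimeAlgebra A] (W : PDO A) (τ : Aˣ) : Prop :=
  W = shift (-2) (τ : A) * HahnSeries.C (↑τ⁻¹ : A)

/-- The action `P(e^{ξ(t,λ)}) = (∑ a_i λ^i) e^{ξ(t,λ)}` of `P = ∑ a_i ∂^i` on the exponential. For
`P = W` this is the wave function `ψ_BA(t,λ)`; for `P = Y ∘ W` it is `Y(ψ_BA(t,λ))`. -/
def applyExp {R : Type*} [CommRing R] (P : PDO R) : BA R := LaurentPolynomial.C P * T 1

/-- The substitution `λ ↦ -λ` in a Laurent series in `λ⁻¹`. -/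
def negSpec {R : Type*} [CommRing R] (f : LaurentSeries R) : LaurentSeries R where
  coeff n := (n.negOnePow : ℤ) • f.coeff n
  isPWO_support' := f.isPWO_support.mono fun n hn hf => hn (by simp [hf])

/-- `P(e^{ξ(t,-λ)})`, where `ξ(t,-λ) = -ξ(t,λ)`. For `P = W` this is `ψ_BA(t,-λ)`. -/
def applyExpNeg {R : Type*} [CommRing R] (P : PDO R) : BA R :=
  LaurentPolynomial.C (negSpec P) * T (-1)

section Main

variable {A : Type*} [CommRing A] [Algebra ℚ A]

/-- The algebra `A((μ⁻¹))[e^{±ξ(t,μ)}]((λ⁻¹))[e^{±ξ(t,λ)}]` of functions of `t` that contain the two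
parameters `μ`, `λ` (expansions in `|λ| > |μ|`). -/
abbrev Fun2 (A : Type*) [CommRing A] : Type _ := BA (BA A)

/-- Functions of `t` alone, inside `Fun2 A`. -/
def toFun2 : A →+* Fun2 A := const.comp const

/-- `ψ_BA(t,μ)`. -/
def psiMu (W : PDO A) : Fun2 A := const (applyExp W)

/-- `ψ_BA(t,-λ)`. -/
def psiNegLambda (W : PDO A) : Fun2 A :=
  applyExpNeg (HahnSeries.map W (const : A →+* BA A))

/-- `W` as an operator with coefficients in `Fun2 A`. -/
def lift2 (W : PDO A) : PDO (Fun2 A) := HahnSeries.map W (toFun2 : A →+* Fun2 A)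

/-- `ψ_BA(t,z)`, in `Fun2 A ((z⁻¹))[e^{±ξ(t,z)}]` (expansions in `|z| > |λ| > |μ|`). -/
def psiZ (W : PDO A) : BA (Fun2 A) := applyExp (lift2 W)

variable [TimeAlgebra A]

/-- `Y(λ,μ) = ψ_BA(t,-λ) ∂⁻¹ ψ_BA(t,μ)_x - ψ_BA(t,μ) ∂⁻¹ ψ_BA(t,-λ)_x`. -/
def opY (W : PDO A) : PDO (Fun2 A) :=
  PDO.comp (PDO.comp (PDO.mulBy (psiNegLambda W)) (PDO.der _ (-1))) (PDO.mulBy (pd 0 (psiMu W))) -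
  PDO.comp (PDO.comp (PDO.mulBy (psiMu W)) (PDO.der _ (-1))) (PDO.mulBy (pd 0 (psiNegLambda W)))

/-- The function `Y(λ,μ)(ψ_BA(t,z)) = (Y(λ,μ) ∘ W)(e^{ξ(t,z)})`. -/
def opYPsi (W : PDO A) : BA (Fun2 A) := applyExp (PDO.comp (opY W) (lift2 W))

/-- The vertex operator
`𝒳(λ,μ) = e^{ξ(t + 2[λ⁻¹], μ) - ξ(t,λ)} exp (∑ 2/(2l-1) (λ^{-(2l-1)} - μ^{-(2l-1)}) ∂/∂t_{2l-1})`.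
The last exponential is the shift `t ↦ t + 2[λ⁻¹] - 2[μ⁻¹]`. -/
def vertexOp (f : A) : Fun2 A :=
  LaurentPolynomial.C (shift 2 (T 1 : BA A)) * T (-1) *
    LaurentPolynomial.C (shift 2 (LaurentPolynomial.C (shift (-2) f) : BA A))

end Main

/-- The infinitesimal change of the wave function `ψ(t,z) = τ(t - 2[z⁻¹]) / τ(t) · e^{ξ(t,z)}` which
is induced by an infinitesimal change `δτ` of `τ`:
`δψ(t,z) = (δτ(t - 2[z⁻¹]) τ(t) - τ(t - 2[z⁻¹]) δτ(t)) / τ(t)² · e^{ξ(t,z)}`. -/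
def inducedVariation {R : Type*} [CommRing R] [Algebra ℚ R] [TimeAlgebra R] (τ : Rˣ) (δτ : R) :
    BA R :=
  LaurentPolynomial.C ((shift (-2) δτ * HahnSeries.C (τ : R) -
    shift (-2) (τ : R) * HahnSeries.C δτ) * HahnSeries.C (↑τ⁻¹ : R) ^ 2) * T 1

/-- The action `𝒳(λ,μ)ψ_BA(t,z)` of the vertex operator on the wave function: the infinitesimal change
of the wave function induced by `δτ = 𝒳(λ,μ)τ`. -/
def vertexPsi {A : Type*} [CommRing A] [Algebra ℚ A] [TimeAlgebra A] (τ : Aˣ) : BA (Fun2 A) :=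
  inducedVariation (Units.map (toFun2 : A →+* Fun2 A).toMonoidHom τ) (vertexOp (τ : A))

end BKP

end

/-! Write `f = ψ(t,-λ)`, `g = ψ(t,μ)`, and `S` for the shift `t ↦ t - 2[z⁻¹]`. Everything follows
from one exchange relation, `ψ(t,z) (S g + g)_x = ψ(t,z)_x (g - S g)` (`exchange`), a differential
form of the Fay identity for BKP. It holds for `g` and, by reflection `μ ↦ -λ`, for `f`.

Given it, three short computations remain. (1) Differentiating `(g - S g) ψ(t,z)` gives `2 g_x
ψ(t,z)`; hence `2 ∂⁻¹(g_x ψ(t,z)) = (g - S g) ψ(t,z)`, and `2 Y ψ(t,z) = ψ(t,z) (g · S f - f · S g)`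
(`two_mul_applyExp_comp`). (2) Splitting the shifts in the vertex operator gives `𝒳τ/τ = Q` with `Q
= f · g(t + 2[λ⁻¹])` (`vertexOp_mul`); the exchange relation at `z = -λ` says `Q_x = f_x g - f g_x`
(`pd_bilinear`). (3) By this, the `x`-derivative of `Δ_z Q - (g · S f - f · S g)` vanishes; this
function is a series in `λ` times `e^{-ξ(t,λ)}`, on which `∂` is injective, so it is zero
(`three_term`).

The exchange relation is proved by a uniqueness argument in `μ`. The BKP constraint makes `W ∂⁻¹ W^*
= ∂⁻¹`, from which the differential operators `(L^{2n+1})₊` have no constant term. Thus every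
`∂/∂t_{2n+1}` maps `ψ` into the span of `∂ψ, ∂²ψ, …` and preserves that span; a nonzero element of
the span has a positive power of `μ` in front of the exponential (`eq_zero_of_mem_waveSpan`). All
`z`-coefficients of the defect of the exchange relation lie in the span. Because `S e^{ξ(t,μ)} = (z
- μ)/(z + μ) e^{ξ(t,μ)}`, the defect times `z + μ` is explicit, and `w₁ = -2 ∂ log τ` cancels its
positive powers of `μ`. Solving for the coefficients in `z` one at a time shows that each of them
vanishes (`exchangeError_eq_zero`). -/

noncomputable section

namespace BKP

open LaurentPolynomial TimeAlgebra

/-! ### Symbol calculus of pseudodifferential operators -/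

section Coefficients

variable {R : Type*} [CommRing R]

theorem coeff_spec_mul (f : LaurentSeries R) (i : ℤ) :
    (spec R * f).coeff i = f.coeff (i + 1) := by
  rw [spec, HahnSeries.coeff_single_mul, one_mul, sub_neg_eq_add]

theorem coeff_spec_pow_mul (k : ℕ) (f : LaurentSeries R) (i : ℤ) :
    (spec R ^ k * f).coeff i = f.coeff (i + k) := by
  induction k generalizing i with
  | zero => simp
  | succ k ih => rw [pow_succ', mul_assoc, coeff_spec_mul, ih]; congr 1; push_cast; ring

namespace PDO

theorem exists_bound (Q : PDO R) : ∃ b, ∀ i < b, Q.coeff i = 0 :=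
  ⟨Q.order, fun _ hi => HahnSeries.coeff_eq_zero_of_lt_order hi⟩

theorem der_mul_der (l m : ℤ) : der R l * der R m = der R (l + m) := by
  rw [der, der, HahnSeries.single_mul_single, one_mul, der, neg_add]

theorem der_zero : der R 0 = 1 := by
  rw [der, neg_zero, HahnSeries.single_zero_one]

end PDO

theorem spec_pow (k : ℕ) : spec R ^ k = PDO.der R k := by
  induction k with
  | zero => rw [pow_zero, Nat.cast_zero, PDO.der_zero]
  | succ k ih => rw [pow_succ, ih, spec, Nat.cast_succ, ← PDO.der_mul_der]; rfl

end Coefficients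

section Calculus

variable {R : Type*} [CommRing R] [Algebra ℚ R] [TimeAlgebra R]

@[simp] theorem coeff_pd (n : ℕ) (f : LaurentSeries R) (i : ℤ) :
    (pd n f).coeff i = pd n (f.coeff i) := rfl

/-- The symbol of `∂ ∘ f`. -/
def dsym : LaurentSeries R →+ LaurentSeries R where
  toFun f := pd 0 f + spec R * f
  map_zero' := by simp
  map_add' f g := by rw [map_add, mul_add]; abel

theorem dsym_apply (f : LaurentSeries R) : dsym f = pd 0 f + spec R * f := rfl

theorem coeff_dsym (f : LaurentSeries R) (i : ℤ) :
    (dsym f).coeff i = pd 0 (f.coeff i) + f.coeff (i + 1) := by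
  rw [dsym_apply, HahnSeries.coeff_add, coeff_spec_mul, coeff_pd]

theorem dsym_mul (f g : LaurentSeries R) : dsym (f * g) = pd 0 f * g + f * dsym g := by
  simp only [dsym_apply, Derivation.leibniz, smul_eq_mul]
  ring

/-- A Laurent series has a first nonzero coefficient, and the coefficient before it is zero. This
starts every induction on coefficients below. -/
theorem coeff_eq_zero_of_recursion {S : Type*} [AddCommGroup S] {f : HahnSeries ℤ S}
    (h : ∀ i, f.coeff i = 0 → f.coeff (i + 1) = 0) : f = 0 := by
  by_contra hf
  have h1 : f.coeff (f.order - 1) = 0 := HahnSeries.coeff_eq_zero_of_lt_order (by omega)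
  have h2 := h _ h1
  rw [sub_add_cancel] at h2
  exact hf (HahnSeries.coeff_order_eq_zero.mp h2)

/-- The leading coefficient of `f` is also that of `∂ ∘ f`. Injectivity lets identities with `∂⁻¹`
be checked after applying `∂`. -/
theorem dsym_injective : Function.Injective (dsym : LaurentSeries R →+ LaurentSeries R) := by
  rw [injective_iff_map_eq_zero]
  intro f hf
  refine coeff_eq_zero_of_recursion fun i hi => ?_
  have := coeff_dsym f i
  rw [hf, hi] at this
  simpa using this.symm

namespace PDO

/-- The symbol of `∂^m ∘ Q`. -/
abbrev derComp (m : ℤ) (Q : PDO R) : PDO R := comp (der R m) Q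

theorem coeff_comp_eq_finsum_finsum (P Q : PDO R) (n : ℤ) : (comp P Q).coeff n =
    ∑ᶠ (i : ℤ) (k : ℕ), P.coeff i * (Ring.choose (-i) k •
      (⇑(pd 0 : Derivation ℚ R R))^[k] (Q.coeff (n - i - k))) :=
  finsum_curry _ (compCoeff_finite P Q n)

theorem coeff_derComp (m : ℤ) (Q : PDO R) (n : ℤ) : (derComp m Q).coeff n =
    ∑ᶠ k : ℕ, Ring.choose m k • (⇑(pd 0 : Derivation ℚ R R))^[k] (Q.coeff (n + m - k)) := by
  rw [coeff_comp_eq_finsum_finsum, finsum_eq_single _ (-m)]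
  · simp [der]
  · intro i hi
    simp [der, HahnSeries.coeff_single_of_ne hi]

theorem coeff_derComp_eq_sum {m : ℤ} {Q : PDO R} {b n : ℤ} (hQ : ∀ i < b, Q.coeff i = 0)
    {N : ℕ} (hN : n + m - b < N) : (derComp m Q).coeff n = ∑ k ∈ Finset.range N,
      Ring.choose m k • (⇑(pd 0 : Derivation ℚ R R))^[k] (Q.coeff (n + m - k)) := by
  rw [coeff_derComp]
  refine finsum_eq_sum_of_support_subset _ fun k hk => ?_
  by_contra hc
  simp only [Finset.coe_range, Set.mem_Iio, not_lt] at hc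
  refine hk ?_
  simp only [hQ (n + m - k) (by omega), iterate_map_zero, smul_zero]

theorem coeff_derComp_of_lt {m : ℤ} {Q : PDO R} {b n : ℤ} (hQ : ∀ i < b, Q.coeff i = 0)
    (h : n < b - m) : (derComp m Q).coeff n = 0 := by
  rw [coeff_derComp_eq_sum hQ (N := 0) (by push_cast; omega), Finset.sum_range_zero]

theorem coeff_derComp_lead {m : ℤ} {Q : PDO R} {b : ℤ} (hQ : ∀ i < b, Q.coeff i = 0) :
    (derComp m Q).coeff (b - m) = Q.coeff b := by
  rw [coeff_derComp_eq_sum hQ (N := 1) (by push_cast; omega), Finset.sum_range_one]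
  simp

theorem derComp_zero (Q : PDO R) : derComp 0 Q = Q := by
  ext n
  rw [coeff_derComp, finsum_eq_single _ 0]
  · simp
  · intro k hk
    rw [Ring.choose_zero_pos ℤ (Nat.pos_of_ne_zero hk), zero_smul]

/-- Pascal's rule for the generalized binomial coefficients, valid for negative `m` too. -/
theorem dsym_derComp (m : ℤ) (Q : PDO R) : dsym (derComp m Q) = derComp (m + 1) Q := by
  obtain ⟨b, hb⟩ := exists_bound Q
  ext n
  obtain ⟨N, hN⟩ : ∃ N : ℕ, n + m + 1 - b < N := ⟨(n + m + 2 - b).toNat, by omega⟩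
  rw [coeff_dsym, coeff_derComp_eq_sum hb (N := N) (by omega),
    coeff_derComp_eq_sum hb (N := N + 1) (by push_cast; omega),
    coeff_derComp_eq_sum hb (N := N + 1) (by push_cast; omega), Finset.sum_range_succ',
    Finset.sum_range_succ' (n := N), ← add_assoc, map_sum, ← Finset.sum_add_distrib]
  congr 1
  · refine Finset.sum_congr rfl fun k _ => ?_
    rw [Ring.choose_succ_succ, add_smul, map_zsmul, Function.iterate_succ_apply']
    rw [show n + 1 + m - (k + 1 : ℕ) = n + m - k by push_cast; ring,
      show n + (m + 1) - (k + 1 : ℕ) = n + m - k by push_cast; ring]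
    simp only [Function.iterate_succ_apply']
  · simp only [Ring.choose_zero_right, CharP.cast_eq_zero]
    congr 3
    ring

/-- Upward the recursion determines `F`; downward it does so because `∂` is injective. Later
identities for `∂^m`, `m ∈ ℤ`, need only the step `m ↦ m + 1` and no binomial sums. -/
theorem derComp_eq_of_recursion {F : ℤ → PDO R} (h : ∀ m, dsym (F m) = F (m + 1)) (m : ℤ) :
    derComp m (F 0) = F m := by
  induction m using Int.induction_on with
  | zero => exact derComp_zero _
  | succ m ih => rw [← dsym_derComp, ih, h]
  | pred m ih =>
    apply dsym_injective
    rw [dsym_derComp, h, sub_add_cancel, ih]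

theorem coeff_comp_eq_finsum (P Q : PDO R) (n : ℤ) : (comp P Q).coeff n =
    ∑ᶠ i : ℤ, P.coeff i * (derComp (-i) Q).coeff n := by
  rw [coeff_comp_eq_finsum_finsum]
  refine finsum_congr fun i => ?_
  rw [coeff_derComp, mul_finsum']
  · simp only [← sub_eq_add_neg]
  · obtain ⟨b, hb⟩ := exists_bound Q
    refine Set.Finite.subset (Set.finite_Iic (n - i - b).toNat) fun k hk => ?_
    by_contra hc
    apply hk
    simp only [Set.mem_Iic, not_le] at hc
    simp only [hb (n + -i - k) (by omega), iterate_map_zero, smul_zero]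

theorem coeff_comp_eq_sum {P Q : PDO R} {a b c n : ℤ} (hP : ∀ i < a, P.coeff i = 0)
    (hQ : ∀ i < b, Q.coeff i = 0) (hc : n - b ≤ c) : (comp P Q).coeff n =
    ∑ i ∈ Finset.Icc a c, P.coeff i * (derComp (-i) Q).coeff n := by
  rw [coeff_comp_eq_finsum]
  refine finsum_eq_sum_of_support_subset _ fun i hi => ?_
  by_contra h
  simp only [Finset.coe_Icc, Set.mem_Icc, not_and_or, not_le] at h
  apply hi
  rcases h with h | h
  · simp only [hP i h, zero_mul]
  · simp only [coeff_derComp_of_lt hQ (m := -i) (n := n) (by omega), mul_zero]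

theorem coeff_comp_of_lt {P Q : PDO R} {a b n : ℤ} (hP : ∀ i < a, P.coeff i = 0)
    (hQ : ∀ i < b, Q.coeff i = 0) (h : n < a + b) : (comp P Q).coeff n = 0 := by
  rw [coeff_comp_eq_sum hP hQ (c := a - 1) (by omega), Finset.Icc_eq_empty (by omega),
    Finset.sum_empty]

theorem coeff_comp_lead {P Q : PDO R} {a b : ℤ} (hP : ∀ i < a, P.coeff i = 0)
    (hQ : ∀ i < b, Q.coeff i = 0) : (comp P Q).coeff (a + b) = P.coeff a * Q.coeff b := by
  rw [coeff_comp_eq_sum hP hQ (c := a) (by omega), Finset.Icc_self, Finset.sum_singleton,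
    show a + b = b - -a by ring, coeff_derComp_lead hQ]

theorem comp_sub_left (P P' Q : PDO R) : comp (P - P') Q = comp P Q - comp P' Q := by
  ext n
  have h1 : ∀ i < min P.order P'.order, P.coeff i = 0 := fun i hi =>
    HahnSeries.coeff_eq_zero_of_lt_order (hi.trans_le (min_le_left _ _))
  have h2 : ∀ i < min P.order P'.order, P'.coeff i = 0 := fun i hi =>
    HahnSeries.coeff_eq_zero_of_lt_order (hi.trans_le (min_le_right _ _))
  have h3 : ∀ i < min P.order P'.order, (P - P').coeff i = 0 := fun i hi => by
    rw [HahnSeries.coeff_sub, h1 i hi, h2 i hi, sub_zero]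
  obtain ⟨b, hb⟩ := exists_bound Q
  rw [HahnSeries.coeff_sub, coeff_comp_eq_sum h1 hb le_rfl, coeff_comp_eq_sum h2 hb le_rfl,
    coeff_comp_eq_sum h3 hb le_rfl, ← Finset.sum_sub_distrib]
  simp only [HahnSeries.coeff_sub, sub_mul]

/-- The case `∂ ∘ (P ∘ Q) = (∂ ∘ P) ∘ Q` of associativity: the Leibniz rule on each term `a_i · (∂^i
∘ Q)`, then a shift of the summation index. -/
theorem dsym_comp (P Q : PDO R) : dsym (comp P Q) = comp (dsym P) Q := by
  obtain ⟨a, ha⟩ := exists_bound P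
  obtain ⟨b, hb⟩ := exists_bound Q
  have ha' : ∀ i < a - 1, P.coeff i = 0 := fun i hi => ha i (by omega)
  have hd : ∀ i < a - 1, (dsym P).coeff i = 0 := fun i hi => by
    rw [coeff_dsym, ha i (by omega), ha (i + 1) (by omega), map_zero, add_zero]
  ext n
  rw [coeff_dsym, coeff_comp_eq_sum ha' hb (c := n + 1 - b) (by omega),
    coeff_comp_eq_sum ha hb (c := n + 1 - b) (by omega),
    coeff_comp_eq_sum hd hb (c := n + 1 - b) (by omega), map_sum]
  simp only [coeff_dsym, add_mul, Derivation.leibniz, smul_eq_mul, Finset.sum_add_distrib]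
  have h1 : ∀ i, P.coeff i * (derComp (-i) Q).coeff (n + 1) =
      P.coeff i * (derComp (-i + 1) Q).coeff n - P.coeff i * pd 0 ((derComp (-i) Q).coeff n) := by
    intro i
    rw [← dsym_derComp, coeff_dsym]
    ring
  -- After the index shift the range ends at `n + 2 - b`; the extra top term vanishes since
  -- `∂^{-i+1} ∘ Q` then starts beyond index `n`.
  have h2 : ∑ i ∈ Finset.Icc (a - 1) (n + 1 - b), P.coeff (i + 1) * (derComp (-i) Q).coeff n =
      ∑ i ∈ Finset.Icc a (n + 1 - b), P.coeff i * (derComp (-i + 1) Q).coeff n := by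
    symm
    refine Finset.sum_subset_zero_on_sdiff (s₁ := Finset.Icc a (n + 1 - b))
      (s₂ := Finset.Icc a (n + 2 - b)) (Finset.Icc_subset_Icc le_rfl (by omega)) ?_
      (fun _ _ => rfl) |>.trans ?_
    · intro i hi
      simp only [Finset.mem_sdiff, Finset.mem_Icc] at hi
      rw [coeff_derComp_of_lt hb (by omega), mul_zero]
    · refine Finset.sum_bij' (fun i _ => i - 1) (fun i _ => i + 1) ?_ ?_ ?_ ?_ ?_
      · intro i hi; simp only [Finset.mem_Icc] at hi ⊢; omega
      · intro i hi; simp only [Finset.mem_Icc] at hi ⊢; omega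
      · intro i _; ring
      · intro i _; ring
      · intro i _; rw [sub_add_cancel]; congr 3; ring
  have h3 : ∑ i ∈ Finset.Icc (a - 1) (n + 1 - b), P.coeff i * pd 0 ((derComp (-i) Q).coeff n) =
      ∑ i ∈ Finset.Icc a (n + 1 - b), P.coeff i * pd 0 ((derComp (-i) Q).coeff n) := by
    symm
    refine Finset.sum_subset (Finset.Icc_subset_Icc (by omega) le_rfl) fun i _ hi => ?_
    simp only [Finset.mem_Icc] at *
    rw [ha i (by omega), zero_mul]
  rw [h2, h3, Finset.sum_congr rfl fun i _ => h1 i, Finset.sum_sub_distrib]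
  simp only [mul_comm ((derComp _ Q).coeff n)]
  abel

theorem comp_derComp (m : ℤ) (P Q : PDO R) : comp (derComp m P) Q = derComp m (comp P Q) := by
  have := derComp_eq_of_recursion (F := fun m => comp (derComp m P) Q)
    (fun m => by rw [dsym_comp, dsym_derComp]) m
  rw [← this, derComp_zero]

/-- By `comp_derComp`, both sides expand into the same finite double sum over the coefficients of
`P` and of `∂^{-i} ∘ Q`. -/
theorem comp_assoc (P Q S : PDO R) : comp (comp P Q) S = comp P (comp Q S) := by
  obtain ⟨a, ha⟩ := exists_bound P
  obtain ⟨b, hb⟩ := exists_bound Q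
  obtain ⟨c, hc⟩ := exists_bound S
  have hPQ : ∀ i < a + b, (comp P Q).coeff i = 0 := fun i hi => coeff_comp_of_lt ha hb hi
  have hQS : ∀ i < b + c, (comp Q S).coeff i = 0 := fun i hi => coeff_comp_of_lt hb hc hi
  ext n
  rw [coeff_comp_eq_sum hPQ hc (c := n - c) le_rfl,
    coeff_comp_eq_sum ha hQS (c := n - (b + c)) le_rfl]
  have h1 : ∀ j ∈ Finset.Icc (a + b) (n - c), (comp P Q).coeff j * (derComp (-j) S).coeff n =
      ∑ i ∈ Finset.Icc a (n - (b + c)),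
        P.coeff i * (derComp (-i) Q).coeff j * (derComp (-j) S).coeff n := by
    intro j hj
    rw [Finset.mem_Icc] at hj
    rw [coeff_comp_eq_sum ha hb (c := n - (b + c)) (by omega), Finset.sum_mul]
  have h2 : ∀ i ∈ Finset.Icc a (n - (b + c)),
      P.coeff i * (derComp (-i) (comp Q S)).coeff n = ∑ j ∈ Finset.Icc (a + b) (n - c),
        P.coeff i * (derComp (-i) Q).coeff j * (derComp (-j) S).coeff n := by
    intro i hi
    rw [Finset.mem_Icc] at hi
    rw [← comp_derComp, coeff_comp_eq_sum (a := a + b) (fun j hj =>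
      coeff_derComp_of_lt hb (by omega)) hc (c := n - c) le_rfl, Finset.mul_sum]
    simp only [mul_assoc]
  rw [Finset.sum_congr rfl h1, Finset.sum_congr rfl h2, Finset.sum_comm]

theorem der_comp_der (m l : ℤ) : comp (der R m) (der R l) = der R (m + l) := by
  have h := derComp_eq_of_recursion (F := fun m => der R (m + l)) (fun m => by
    ext n
    rw [coeff_dsym]
    have h0 : ∀ i k : ℤ, pd 0 ((der R k).coeff i) = 0 := by
      intro i k
      by_cases hi : i = -k <;> simp [der, hi]
    rw [h0, zero_add, der, der]
    by_cases h : n = -(m + 1 + l)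
    · rw [h, show -(m + 1 + l) + 1 = -(m + l) by ring, HahnSeries.coeff_single_same,
        HahnSeries.coeff_single_same]
    · rw [HahnSeries.coeff_single_of_ne h, HahnSeries.coeff_single_of_ne (by omega)]) m
  rwa [zero_add] at h

theorem comp_der (P : PDO R) (m : ℤ) : comp P (der R m) = der R m * P := by
  ext n
  rw [coeff_comp_eq_finsum, finsum_eq_single _ (n + m)]
  · rw [derComp, der_comp_der, der, der, HahnSeries.coeff_single_mul, show -(-(n + m) + m) = n by ring,
      HahnSeries.coeff_single_same, mul_one, one_mul, sub_neg_eq_add]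
  · intro i hi
    rw [derComp, der_comp_der, der, HahnSeries.coeff_single_of_ne (by omega), mul_zero]

theorem mulBy_comp (f : R) (Q : PDO R) : comp (mulBy f) Q = HahnSeries.C f * Q := by
  ext n
  rw [coeff_comp_eq_finsum, finsum_eq_single _ 0]
  · simp [mulBy, derComp_zero]
  · intro i hi
    rw [mulBy, HahnSeries.C_apply, HahnSeries.coeff_single_of_ne hi, zero_mul]

end PDO

end Calculus

/-! ### The reflection `λ ↦ -λ`, adjoints and residues -/

section NegSpec

variable {R : Type*} [CommRing R]

theorem coeff_mul_eq_finsum (f g : LaurentSeries R) (n : ℤ) :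
    (f * g).coeff n = ∑ᶠ i : ℤ, f.coeff i * g.coeff (n - i) := by
  classical
  rw [HahnSeries.coeff_mul, finsum_eq_sum_of_support_subset (s := (Finset.antidiagonal
    f.isPWO_support g.isPWO_support n).image Prod.fst), Finset.sum_image]
  · refine Finset.sum_congr rfl fun ij hij => ?_
    rw [Finset.mem_antidiagonal] at hij
    rw [← hij.2.2, add_sub_cancel_left]
  · intro x hx y hy hxy
    simp only [Finset.mem_coe, Finset.mem_antidiagonal] at hx hy
    ext
    · exact hxy
    · have := hx.2.2.trans hy.2.2.symm
      have h1 : x.1 = y.1 := hxy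
      omega
  · intro i hi
    rw [Finset.mem_coe, Finset.mem_image]
    refine ⟨(i, n - i), ?_, rfl⟩
    rw [Finset.mem_antidiagonal]
    exact ⟨left_ne_zero_of_mul hi, right_ne_zero_of_mul hi, by ring⟩

theorem coeff_mul_of_lt {f g : LaurentSeries R} {a b n : ℤ} (hf : ∀ i < a, f.coeff i = 0)
    (hg : ∀ i < b, g.coeff i = 0) (h : n < a + b) : (f * g).coeff n = 0 := by
  rw [coeff_mul_eq_finsum]
  refine finsum_eq_zero_of_forall_eq_zero fun i => ?_
  by_cases hi : i < a
  · rw [hf i hi, zero_mul]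
  · rw [hg (n - i) (by omega), mul_zero]

theorem coeff_negSpec (f : LaurentSeries R) (n : ℤ) :
    (negSpec f).coeff n = (n.negOnePow : ℤ) • f.coeff n := rfl

theorem negSpec_add (f g : LaurentSeries R) : negSpec (f + g) = negSpec f + negSpec g := by
  ext n
  simp only [coeff_negSpec, HahnSeries.coeff_add, smul_add]

theorem negSpec_negSpec (f : LaurentSeries R) : negSpec (negSpec f) = f := by
  ext n
  rw [coeff_negSpec, coeff_negSpec, smul_smul, ← Units.val_mul, ← Int.negOnePow_add,
    Int.negOnePow_even _ (Even.add_self n), Units.val_one, one_smul]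

theorem negSpec_single (k : ℤ) (a : R) : negSpec (HahnSeries.single k a) =
    HahnSeries.single k ((k.negOnePow : ℤ) • a) := by
  ext n
  rw [coeff_negSpec]
  by_cases h : n = k
  · subst h
    simp
  · simp [HahnSeries.coeff_single_of_ne h]

theorem negSpec_mul (f g : LaurentSeries R) : negSpec (f * g) = negSpec f * negSpec g := by
  ext n
  rw [coeff_negSpec, coeff_mul_eq_finsum, coeff_mul_eq_finsum, smul_finsum']
  · refine finsum_congr fun i => ?_
    rw [coeff_negSpec, coeff_negSpec, smul_mul_smul_comm, ← Units.val_mul, ← Int.negOnePow_add,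
      add_sub_cancel]
  · obtain ⟨a, ha⟩ := PDO.exists_bound f
    obtain ⟨b, hb⟩ := PDO.exists_bound g
    refine Set.Finite.subset (Set.finite_Icc a (n - b)) fun i hi => ?_
    by_contra hc
    apply hi
    simp only [Set.mem_Icc, not_and_or, not_le] at hc
    rcases hc with h | h
    · simp only [ha i h, zero_mul]
    · simp only [hb (n - i) (by omega), mul_zero]

/-- The substitution `λ ↦ -λ` as a ring homomorphism. -/
def negSpecHom : LaurentSeries R →+* LaurentSeries R where
  toFun := negSpec
  map_one' := by
    rw [← HahnSeries.single_zero_one, negSpec_single, Int.negOnePow_zero, Units.val_one, one_smul]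
  map_mul' := negSpec_mul
  map_zero' := by ext n; simp [coeff_negSpec]
  map_add' := negSpec_add

@[simp] theorem negSpecHom_apply (f : LaurentSeries R) : negSpecHom f = negSpec f := rfl

theorem negSpec_C (a : R) : negSpec (HahnSeries.C a) = HahnSeries.C a := by
  rw [HahnSeries.C_apply, negSpec_single, Int.negOnePow_zero, Units.val_one, one_smul]

theorem negSpec_spec : negSpec (spec R) = -spec R := by
  rw [spec, negSpec_single, Int.negOnePow_neg, Int.negOnePow_one]
  simp

/-- The product `f(λ) f(-λ)` is even. -/
theorem coeff_mul_negSpec_of_odd [Algebra ℚ R] (f : LaurentSeries R) {n : ℤ} (hn : Odd n) :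
    (f * negSpec f).coeff n = 0 := by
  have h1 := coeff_negSpec (f * negSpec f) n
  rw [negSpec_mul, negSpec_negSpec, mul_comm, Int.negOnePow_odd n hn] at h1
  simp only [Units.val_neg, Units.val_one, neg_smul, one_smul] at h1
  have h2 : (2 : ℚ) • (f * negSpec f).coeff n = 0 := by
    rw [two_smul]
    nth_rw 1 [h1]
    exact neg_add_cancel _
  simpa using h2

end NegSpec

section Adjoint

variable {R : Type*} [CommRing R] [Algebra ℚ R] [TimeAlgebra R]

theorem pd_negSpec (n : ℕ) (f : LaurentSeries R) : pd n (negSpec f) = negSpec (pd n f) := by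
  ext i
  rw [coeff_pd, coeff_negSpec, coeff_negSpec, coeff_pd, map_zsmul]

namespace PDO

theorem coeff_adj (P : PDO R) (n : ℤ) : (adj P).coeff n = adjCoeff P n := rfl

theorem coeff_adj_eq_sum {P : PDO R} {b n : ℤ} (hP : ∀ i < b, P.coeff i = 0) {N : ℕ}
    (hN : n - b < N) : (adj P).coeff n = ∑ k ∈ Finset.range N, ((n - k).negOnePow : ℤ) •
      (Ring.choose (-(n - k)) k • (⇑(pd 0 : Derivation ℚ R R))^[k] (P.coeff (n - k))) := by
  refine finsum_eq_sum_of_support_subset _ fun k hk => ?_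
  by_contra hc
  simp only [Finset.coe_range, Set.mem_Iio, not_lt] at hc
  refine hk ?_
  simp only [hP (n - k) (by omega), iterate_map_zero, smul_zero]

/-- This is `(P ∂)^* = -∂ P^*`, since `spec R * P` is the symbol of `P ∘ ∂`; the proof is again
Pascal's rule. -/
theorem dsym_adj (P : PDO R) : dsym (adj P) = -adj (spec R * P) := by
  obtain ⟨b, hb⟩ := exists_bound P
  have hb' : ∀ i < b - 1, (spec R * P).coeff i = 0 := fun i hi => by
    rw [coeff_spec_mul, hb _ (by omega)]
  ext n
  obtain ⟨N, hN⟩ : ∃ N : ℕ, n + 1 - b < N := ⟨(n + 2 - b).toNat, by omega⟩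
  rw [coeff_dsym, HahnSeries.coeff_neg, coeff_adj_eq_sum hb (N := N) (by omega),
    coeff_adj_eq_sum hb (N := N + 1) (by push_cast; omega),
    coeff_adj_eq_sum hb' (N := N + 1) (by push_cast; omega), Finset.sum_range_succ',
    Finset.sum_range_succ' (n := N), ← add_assoc, map_sum, ← Finset.sum_add_distrib, neg_add,
    ← Finset.sum_neg_distrib]
  congr 1
  · refine Finset.sum_congr rfl fun k _ => ?_
    rw [coeff_spec_mul, show n + 1 - (k + 1 : ℕ) = n - k by push_cast; ring,
      show n - (k + 1 : ℕ) + 1 = n - k by push_cast; ring,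
      show n - (k + 1 : ℕ) = n - k - 1 by push_cast; ring,
      show -(n - k - 1 : ℤ) = -(n - k) + 1 by ring, Ring.choose_succ_succ, add_smul,
      Int.negOnePow_sub (n - k) 1, Int.negOnePow_one, map_zsmul, map_zsmul, Function.iterate_succ_apply']
    simp only [mul_neg, mul_one, Units.val_neg, neg_smul, neg_add, neg_neg, smul_add]
  · rw [coeff_spec_mul]
    simp only [Nat.cast_zero, sub_zero, Ring.choose_zero_right, one_smul, Function.iterate_zero,
      id_eq, Int.negOnePow_succ, Units.val_neg, neg_smul]

theorem derComp_adj (m : ℤ) (Q : PDO R) :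
    derComp m (adj Q) = (m.negOnePow : ℤ) • adj (der R m * Q) := by
  have h := derComp_eq_of_recursion (F := fun m => (m.negOnePow : ℤ) • adj (der R m * Q))
    (fun m => by
      rw [map_zsmul, dsym_adj, Int.negOnePow_succ, Units.val_neg, neg_smul, smul_neg, ← mul_assoc,
        add_comm m, ← der_mul_der]
      rfl) m
  rwa [Int.negOnePow_zero, Units.val_one, one_smul, der_zero, one_mul] at h

theorem coeff_one_adj (P : PDO R) : (adj P).coeff 1 = -P.coeff 1 := by
  rw [coeff_adj, adjCoeff, finsum_eq_single _ 0]
  · simp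
  · intro k hk
    obtain ⟨j, rfl⟩ := Nat.exists_eq_succ_of_ne_zero hk
    -- The binomial coefficient is `(j choose j + 1) = 0`: derivative terms do not contribute to the
    -- residue of an adjoint.
    rw [show -(1 - (j.succ : ℕ) : ℤ) = (j : ℕ) by push_cast; ring, Ring.choose_natCast,
      Nat.choose_eq_zero_of_lt j.lt_succ_self, Nat.cast_zero, zero_smul, smul_zero]

/-- The residue of `P Q^*` is the residue of `P(e^ξ(t,λ)) · Q(e^ξ(t,-λ))` in `λ`. -/
theorem coeff_one_comp_adj (P Q : PDO R) :
    (comp P (adj Q)).coeff 1 = (P * negSpec Q).coeff 1 := by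
  rw [coeff_comp_eq_finsum, coeff_mul_eq_finsum]
  refine finsum_congr fun i => ?_
  rw [derComp_adj, HahnSeries.coeff_smul, coeff_one_adj, der, HahnSeries.coeff_single_mul,
    coeff_negSpec, neg_neg, one_mul, Int.negOnePow_sub, Int.negOnePow_one, Int.negOnePow_neg]
  simp

end PDO

end Adjoint

/-! ### Consequences of Sato's equations and of the BKP constraint -/

section Wave

variable {R : Type*} [CommRing R] [Algebra ℚ R] [TimeAlgebra R]

theorem pd_C (n : ℕ) (a : R) : pd n (HahnSeries.C a : LaurentSeries R) = HahnSeries.C (pd n a) := by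
  ext i
  rw [coeff_pd]
  by_cases hi : i = 0 <;> simp [hi]

theorem pd_spec (n : ℕ) : pd n (spec R) = 0 := by
  ext l
  rw [coeff_pd]
  by_cases hl : l = -1 <;> simp [spec, hl]

theorem pd_spec_pow (n k : ℕ) : pd n (spec R ^ k) = 0 := by
  rw [Derivation.leibniz_pow, pd_spec, smul_zero, smul_zero]

/-- The symbol of `∂/∂t_{2n+1}` acting on `f(λ) e^{ξ(t,λ)}`. -/
def tsym (n : ℕ) : LaurentSeries R →+ LaurentSeries R where
  toFun f := pd n f + spec R ^ (2 * n + 1) * f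
  map_zero' := by simp
  map_add' f g := by rw [map_add, mul_add]; abel

theorem tsym_apply (n : ℕ) (f : LaurentSeries R) :
    tsym n f = pd n f + spec R ^ (2 * n + 1) * f := rfl

theorem tsym_zero (f : LaurentSeries R) : tsym 0 f = dsym f := by
  rw [tsym_apply, dsym_apply, mul_zero, zero_add, pow_one]

theorem dsym_tsym (n : ℕ) (f : LaurentSeries R) : dsym (tsym n f) = tsym n (dsym f) := by
  simp only [tsym_apply, dsym_apply, map_add, Derivation.leibniz, pd_spec_pow, pd_spec, smul_eq_mul,
    mul_zero, add_zero, pd_comm 0 n f]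
  ring

theorem tsym_smul (n : ℕ) (c : R) (f : LaurentSeries R) :
    tsym n (c • f) = pd n c • f + c • tsym n f := by
  simp only [tsym_apply, ← HahnSeries.C_mul_eq_smul, Derivation.leibniz, pd_C, smul_eq_mul]
  ring

namespace PDO

theorem tsym_derComp (n : ℕ) (m : ℤ) (f : PDO R) :
    tsym n (derComp m f) = derComp m (tsym n f) := by
  have h := derComp_eq_of_recursion (F := fun m => tsym n (derComp m f))
    (fun m => by rw [dsym_tsym, dsym_derComp]) m
  rw [← h, derComp_zero]

/-- A differential operator acts on symbols by a finite sum. -/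
theorem comp_eq_sum_of_differential {P : PDO R} (hP : ∀ i, 0 < i → P.coeff i = 0) (Q : PDO R) :
    ∃ N : ℕ, comp P Q = ∑ i ∈ Finset.range (N + 1), 
      HahnSeries.C (P.coeff (-i)) * derComp (i : ℤ) Q := by
  obtain ⟨a, ha⟩ := exists_bound P
  refine ⟨(-a).toNat, ?_⟩
  ext n
  rw [coeff_comp_eq_finsum, finsum_eq_sum_of_support_subset
    (s := (Finset.range ((-a).toNat + 1)).image fun i : ℕ => -(i : ℤ)), Finset.sum_image,
    HahnSeries.coeff_sum]
  · simp only [neg_neg, HahnSeries.C_mul_eq_smul, HahnSeries.coeff_smul, smul_eq_mul]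
  · intro x _ y _ h
    simpa using h
  · intro i hi
    by_contra hc
    refine hi ?_
    have : P.coeff i = 0 := by
      by_cases h0 : 0 < i
      · exact hP i h0
      · refine ha i ?_
        by_contra h1
        refine hc (Finset.mem_coe.mpr (Finset.mem_image.mpr ⟨(-i).toNat, ?_, ?_⟩))
        · rw [Finset.mem_range]; omega
        · omega
    simp only [this, zero_mul]

/-- `W` is monic of order zero, so `P` and `P ∘ W` have the same leading coefficient. -/
theorem eq_zero_of_comp_eq_zero {P W : PDO R} (h0 : W.coeff 0 = 1) (hneg : ∀ n < 0, W.coeff n = 0)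
    (h : comp P W = 0) : P = 0 := by
  refine coeff_eq_zero_of_recursion fun i _ => ?_
  by_contra hi
  have h1 : P ≠ 0 := by rintro rfl; exact hi rfl
  have h2 := coeff_comp_lead (P := P) (a := P.order)
    (fun i hi => HahnSeries.coeff_eq_zero_of_lt_order hi) hneg
  rw [h, h0, mul_one] at h2
  exact h1 (HahnSeries.coeff_order_eq_zero.mp h2.symm)

end PDO

namespace IsDressing

open PDO

variable {L W : PDO R}

theorem pow_lax_comp (hW : IsDressing L W) (m : ℕ) : comp (pow L m) W = comp W (der R m) := by
  induction m with
  | zero => rw [pow, ← derComp, derComp_zero, comp_der, Nat.cast_zero, der_zero, one_mul]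
  | succ m ih =>
    rw [pow, comp_assoc, ih, ← comp_assoc, hW.lax, comp_assoc, der_comp_der, Nat.cast_succ,
      add_comm]

/-- Sato's equation combined with `L^{2n+1} W = W ∂^{2n+1}`: the wave function satisfies
`∂ψ/∂t_{2n+1} = (L^{2n+1})₊ ψ`. -/
theorem tsym_eq_comp (hW : IsDressing L W) (n : ℕ) :
    tsym n W = comp ((HahnSeries.truncLT 1) (pow L (2 * n + 1))) W := by
  rw [tsym_apply, hW.sato, minus, comp_sub_left, hW.pow_lax_comp, comp_der, spec_pow]
  ring

/-- The constraint says that `W ∂⁻¹ W^* ∂` fixes `W` under left composition. Right cancellation of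
`W` makes this operator the identity. -/
theorem comp_adj (hW : IsDressing L W) : comp (comp W (der R (-1))) (adj W) = der R (-1) := by
  have h1 : comp (comp (comp W (der R (-1))) (adj W)) (der R 1) - der R 0 = 0 := by
    refine eq_zero_of_comp_eq_zero hW.coeff_zero hW.coeff_neg ?_
    rw [comp_sub_left, comp_assoc, comp_assoc, comp_assoc, ← comp_assoc (adj W), hW.constraint,
      der_comp_der, comp_der, ← derComp, derComp_zero, neg_add_cancel, der_zero, one_mul, sub_self]
  have h2 := congrArg (fun X => comp X (der R (-1))) (sub_eq_zero.mp h1)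
  rwa [comp_assoc, der_comp_der, comp_der, add_neg_cancel, der_comp_der, der_zero, one_mul,
    zero_add] at h2

/-- The bilinear identity: the residue of `λ⁻¹ ∂^i ψ(t,λ) ψ(t,-λ)` is `1` for `i = 0` and `0` for
`i > 0`. -/
theorem coeff_zero_derComp_mul_negSpec (hW : IsDressing L W) (i : ℕ) :
    (derComp (i : ℤ) W * negSpec W).coeff 0 = if i = 0 then 1 else 0 := by
  have h := coeff_one_comp_adj (derComp (i : ℤ) (comp W (der R (-1)))) W
  -- The operator whose residue is taken equals `∂^i W ∂⁻¹ W^* = ∂^{i-1}`.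
  rw [comp_derComp, hW.comp_adj, derComp, der_comp_der, ← comp_derComp, comp_der, mul_assoc] at h
  conv_rhs at h => rw [der, HahnSeries.coeff_single_mul, one_mul]
  norm_num at h
  rw [← h, der]
  split_ifs with hi
  · subst hi
    simp
  · rw [HahnSeries.coeff_single_of_ne (by omega)]

/-- Pairing `∂ψ/∂t_{2n+1} = ∑ p_i ∂^i ψ` with `ψ(t,-λ)` through the bilinear identity isolates `p₀`
on the right, and the left side pairs to zero. -/
theorem coeff_zero_truncLT_pow (hW : IsDressing L W) (n : ℕ) :
    ((HahnSeries.truncLT 1) (pow L (2 * n + 1)) : PDO R).coeff 0 = 0 := by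
  set P : PDO R := (HahnSeries.truncLT 1) (pow L (2 * n + 1)) with hPdef
  have hP : ∀ i, 0 < i → P.coeff i = 0 := fun i hi => HahnSeries.coeff_truncLT_of_le hi _
  obtain ⟨N, hN⟩ := comp_eq_sum_of_differential hP W
  rw [← hW.tsym_eq_comp] at hN
  have h := congrArg (fun f : LaurentSeries R => (f * negSpec W).coeff 0) hN
  simp only [Finset.sum_mul, mul_assoc] at h
  simp only [HahnSeries.coeff_sum, HahnSeries.C_mul_eq_smul,
    HahnSeries.coeff_smul, hW.coeff_zero_derComp_mul_negSpec, tsym_apply, add_mul,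
    HahnSeries.coeff_add] at h
  -- The term `λ^{2n+1} W(λ) W(-λ)` has no constant coefficient by parity, and `∂W/∂t_{2n+1}` starts
  -- at `λ⁻¹`.
  rw [mul_assoc, coeff_spec_pow_mul, coeff_mul_negSpec_of_odd W ⟨n, by push_cast; ring⟩,
    coeff_mul_of_lt (a := 1) (b := 0) _ _ (by norm_num)] at h
  · simpa using h.symm
  · intro i hi
    rw [coeff_pd]
    obtain rfl | hi' := eq_or_lt_of_le (Int.lt_add_one_iff.mp hi : i ≤ 0)
    · rw [hW.coeff_zero, Derivation.map_one_eq_zero]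
    · rw [hW.coeff_neg i hi', map_zero]
  · intro i hi
    rw [coeff_negSpec, hW.coeff_neg i hi, smul_zero]

end IsDressing

/-- The span of the symbols of `∂ψ, ∂²ψ, …`, where `ψ = W(e^ξ)`. -/
def waveSpan (W : PDO R) : Submodule R (LaurentSeries R) :=
  Submodule.span R (Set.range fun k : ℕ => PDO.derComp (k + 1 : ℤ) W)

theorem dsym_mem_waveSpan {W : PDO R} {h : LaurentSeries R} (hh : h ∈ waveSpan W) :
    dsym h ∈ waveSpan W := by
  induction hh using Submodule.span_induction with
  | mem x hx =>
    obtain ⟨k, rfl⟩ := hx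
    refine Submodule.subset_span ⟨k + 1, ?_⟩
    simp only
    rw [PDO.dsym_derComp]
    push_cast
    rfl
  | zero => rw [map_zero]; exact zero_mem _
  | add x y _ _ hx hy => rw [map_add]; exact add_mem hx hy
  | smul c x hx ih =>
    rw [← tsym_zero, tsym_smul, tsym_zero]
    exact add_mem (Submodule.smul_mem _ _ hx) (Submodule.smul_mem _ _ ih)

theorem derComp_mem_waveSpan {W : PDO R} {h : LaurentSeries R} (hh : h ∈ waveSpan W) (k : ℕ) :
    PDO.derComp k h ∈ waveSpan W := by
  induction k with
  | zero => rwa [Nat.cast_zero, PDO.derComp_zero]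
  | succ k ih =>
    rw [Nat.cast_succ, ← PDO.dsym_derComp]
    exact dsym_mem_waveSpan ih

/-- The vanishing constant term of `(L^{2n+1})₊` removes `ψ` itself from the sum. -/
theorem IsDressing.tsym_mem_waveSpan {L W : PDO R} (hW : IsDressing L W) (n : ℕ) :
    tsym n W ∈ waveSpan W := by
  obtain ⟨N, hN⟩ := PDO.comp_eq_sum_of_differential
    (P := (HahnSeries.truncLT 1) (PDO.pow L (2 * n + 1)))
    (fun i hi => HahnSeries.coeff_truncLT_of_le hi _) W
  rw [hW.tsym_eq_comp, hN, Finset.sum_range_succ']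
  simp only [HahnSeries.C_mul_eq_smul]
  refine add_mem (sum_mem fun k _ => Submodule.smul_mem _ _ (Submodule.subset_span ⟨k, ?_⟩)) ?_
  · simp only [Nat.cast_succ]
  · rw [Nat.cast_zero, neg_zero, hW.coeff_zero_truncLT_pow, zero_smul]
    exact zero_mem _

theorem IsDressing.tsym_mem_waveSpan_of_mem {L W : PDO R} (hW : IsDressing L W) (n : ℕ)
    {h : LaurentSeries R} (hh : h ∈ waveSpan W) : tsym n h ∈ waveSpan W := by
  induction hh using Submodule.span_induction with
  | mem x hx =>
    obtain ⟨k, rfl⟩ := hx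
    simp only
    rw [PDO.tsym_derComp]
    exact derComp_mem_waveSpan (hW.tsym_mem_waveSpan n) (k + 1)
  | zero => rw [map_zero]; exact zero_mem _
  | add x y _ _ hx hy => rw [map_add]; exact add_mem hx hy
  | smul c x hx ih =>
    rw [tsym_smul]
    exact add_mem (Submodule.smul_mem _ _ hx) (Submodule.smul_mem _ _ ih)

theorem IsDressing.eq_zero_of_mem_waveSpan {L W : PDO R} (hW : IsDressing L W)
    {h : LaurentSeries R} (hh : h ∈ waveSpan W) (hreg : ∀ n < 0, h.coeff n = 0) : h = 0 := by
  obtain ⟨c, rfl⟩ := Finsupp.mem_span_range_iff_exists_finsupp.mp hh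
  by_contra hne
  have hc : c.support.Nonempty := by
    rw [Finsupp.support_nonempty_iff]
    rintro rfl
    exact hne Finsupp.sum_zero_index
  set K := c.support.max' hc
  have hK : K ∈ c.support := Finset.max'_mem _ hc
  -- Only `∂^{K+1} ψ`, the highest derivative present, reaches `λ^{K+1}`, and its coefficient there
  -- is `1`; regularity therefore kills `c K`.
  have h1 := hreg (-(K + 1 : ℤ)) (by omega)
  rw [Finsupp.sum, HahnSeries.coeff_sum, Finset.sum_eq_single K] at h1
  · rw [HahnSeries.coeff_smul, ← zero_sub, PDO.coeff_derComp_lead hW.coeff_neg, hW.coeff_zero,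
      smul_eq_mul, mul_one] at h1
    exact Finsupp.mem_support_iff.mp hK h1
  · intro k hk hkK
    have h2 : k ≤ K := Finset.le_max' _ _ hk
    rw [HahnSeries.coeff_smul, PDO.coeff_derComp_of_lt hW.coeff_neg (by omega), smul_zero]
  · exact fun h => absurd hK h

end Wave

/-! ### Shifts of the times as solutions of a linear differential equation in `z⁻¹` -/

section Euler

variable {R : Type*} [CommRing R]

/-- Laurent series without positive powers of the spectral parameter. -/
def IsRegular (f : LaurentSeries R) : Prop := ∀ i < 0, f.coeff i = 0

theorem isRegular_C (a : R) : IsRegular (HahnSeries.C a : LaurentSeries R) := fun i hi => by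
  rw [HahnSeries.C_apply, HahnSeries.coeff_single_of_ne hi.ne]

theorem isRegular_ofPowerSeries (f : PowerSeries R) : IsRegular (HahnSeries.ofPowerSeries ℤ R f) :=
  fun i hi => by
    rw [HahnSeries.ofPowerSeries_apply]
    refine HahnSeries.embDomain_of_notMem_range ?_
    rintro ⟨k, rfl⟩
    simp at hi
    omega

theorem IsRegular.add {f g : LaurentSeries R} (hf : IsRegular f) (hg : IsRegular g) :
    IsRegular (f + g) := fun i hi => by rw [HahnSeries.coeff_add, hf i hi, hg i hi, add_zero]

theorem IsRegular.sub {f g : LaurentSeries R} (hf : IsRegular f) (hg : IsRegular g) :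
    IsRegular (f - g) := fun i hi => by rw [HahnSeries.coeff_sub, hf i hi, hg i hi, sub_zero]

theorem IsRegular.mul {f g : LaurentSeries R} (hf : IsRegular f) (hg : IsRegular g) :
    IsRegular (f * g) := fun i hi => coeff_mul_of_lt hf hg (by omega)

theorem coeff_mul_eq_sum {f g : LaurentSeries R} {a b n : ℤ} (hf : ∀ i < a, f.coeff i = 0)
    (hg : ∀ i < b, g.coeff i = 0) :
    (f * g).coeff n = ∑ i ∈ Finset.Icc a (n - b), f.coeff i * g.coeff (n - i) := by
  rw [coeff_mul_eq_finsum]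
  refine finsum_eq_sum_of_support_subset _ fun i hi => ?_
  by_contra h
  simp only [Finset.coe_Icc, Set.mem_Icc, not_and_or, not_le] at h
  apply hi
  rcases h with h | h
  · simp only [hf i h, zero_mul]
  · simp only [hg (n - i) (by omega), mul_zero]

theorem coeff_zero_mul {f g : LaurentSeries R} (hf : IsRegular f) (hg : IsRegular g) :
    (f * g).coeff 0 = f.coeff 0 * g.coeff 0 := by
  rw [coeff_mul_eq_sum hf hg, sub_zero, Finset.Icc_self, Finset.sum_singleton, sub_zero]

theorem single_eq_C_mul (k : ℤ) (a : R) : (HahnSeries.single k a : LaurentSeries R) =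
    HahnSeries.C a * HahnSeries.single k 1 := by
  rw [HahnSeries.C_apply, HahnSeries.single_mul_single, zero_add, mul_one]

variable [Algebra ℚ R]

/-- The Euler derivation, which multiplies `z⁻ᵏ` by `k`. -/
def euler : Derivation ℚ (LaurentSeries R) (LaurentSeries R) :=
  Derivation.mk'
    { toFun := fun f =>
        { coeff := fun k => k • f.coeff k
          isPWO_support' := f.isPWO_support.mono fun n hn hf => hn (by simp [hf]) }
      map_add' := fun f g => by ext n; simp
      map_smul' := fun c f => by ext n; simp }
    (fun f g => by
      obtain ⟨a, ha⟩ := PDO.exists_bound f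
      obtain ⟨b, hb⟩ := PDO.exists_bound g
      ext n
      simp only [LinearMap.coe_mk, AddHom.coe_mk, smul_eq_mul, HahnSeries.coeff_add]
      rw [mul_comm g, coeff_mul_eq_sum ha hb, coeff_mul_eq_sum (a := a) (b := b) ha,
        coeff_mul_eq_sum (a := a) (b := b) _ hb, Finset.smul_sum, ← Finset.sum_add_distrib]
      · refine Finset.sum_congr rfl fun i _ => ?_
        simp only [zsmul_eq_mul]
        push_cast
        ring
      · intro i hi
        simp [ha i hi]
      · intro i hi
        simp [hb i hi])

theorem coeff_euler (f : LaurentSeries R) (k : ℤ) : (euler f).coeff k = k • f.coeff k := rfl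

theorem euler_single (k : ℤ) (a : R) :
    euler (HahnSeries.single k a) = k • HahnSeries.single k a := by
  ext n
  rw [coeff_euler, HahnSeries.coeff_smul]
  by_cases h : n = k
  · rw [h]
  · rw [HahnSeries.coeff_single_of_ne h, smul_zero, smul_zero]

end Euler

section Flow

variable {R : Type*} [CommRing R] [Algebra ℚ R] [TimeAlgebra R]

/-- The derivation `∑_{n < N} c_n z^{-(2n+1)} ∂/∂t_{2n+1}`. -/
def timeDer (c : ℕ → ℚ) (N : ℕ) : Derivation ℚ (LaurentSeries R) (LaurentSeries R) :=
  ∑ n ∈ Finset.range N, (HahnSeries.single (2 * n + 1 : ℤ) (algebraMap ℚ R (c n))) • pd n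

theorem timeDer_apply (c : ℕ → ℚ) (N : ℕ) (f : LaurentSeries R) : timeDer c N f =
    ∑ n ∈ Finset.range N, HahnSeries.single (2 * n + 1 : ℤ) (algebraMap ℚ R (c n)) * pd n f := by
  induction N with
  | zero => simp [timeDer]
  | succ N ih =>
    rw [timeDer, Finset.sum_range_succ, Derivation.add_apply, ← timeDer, ih, Finset.sum_range_succ]
    rfl

theorem coeff_timeDer (c : ℕ → ℚ) (N : ℕ) (f : LaurentSeries R) (k : ℤ) : (timeDer c N f).coeff k =
    ∑ n ∈ Finset.range N, c n • pd n (f.coeff (k - (2 * n + 1))) := by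
  simp only [timeDer_apply, HahnSeries.coeff_sum, HahnSeries.coeff_single_mul, coeff_pd,
    Algebra.smul_def]

theorem pd_single_algebraMap (n : ℕ) (k : ℤ) (c : ℚ) :
    pd n (HahnSeries.single k (algebraMap ℚ R c) : LaurentSeries R) = 0 := by
  ext i
  rw [coeff_pd]
  by_cases hi : i = k
  · rw [hi, HahnSeries.coeff_single_same, Derivation.map_algebraMap]
    rfl
  · rw [HahnSeries.coeff_single_of_ne hi, map_zero]
    rfl

theorem timeDer_comm (c d : ℕ → ℚ) (N : ℕ) (f : LaurentSeries R) :
    timeDer c N (timeDer d N f) = timeDer d N (timeDer c N f) := by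
  simp only [timeDer_apply, map_sum, Finset.mul_sum, Derivation.leibniz, pd_single_algebraMap,
    smul_eq_mul, mul_zero, Finset.sum_const_zero, add_zero]
  rw [Finset.sum_comm]
  refine Finset.sum_congr rfl fun m _ => Finset.sum_congr rfl fun n _ => ?_
  rw [pd_comm]
  ring

theorem euler_timeDer (c : ℚ) (N : ℕ) (f : LaurentSeries R) :
    euler (timeDer (fun n => c / (2 * n + 1)) N f) =
      timeDer (fun n => c / (2 * n + 1)) N (euler f) + timeDer (fun _ => c) N f := by
  ext k
  simp only [coeff_euler, HahnSeries.coeff_add, coeff_timeDer, Finset.smul_sum,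
    ← Finset.sum_add_distrib, map_zsmul]
  refine Finset.sum_congr rfl fun n _ => ?_
  have h : (2 * n + 1 : ℚ) ≠ 0 := by positivity
  rw [← Int.cast_smul_eq_zsmul ℚ, ← Int.cast_smul_eq_zsmul ℚ, smul_smul, smul_smul, ← add_smul]
  congr 1
  push_cast
  field_simp
  ring

theorem coeff_timeDer_of_lt (c : ℕ → ℚ) (N : ℕ) {f : LaurentSeries R} {m k : ℤ}
    (hf : ∀ i < m, f.coeff i = 0) (hk : k < m + 1) : (timeDer c N f).coeff k = 0 := by
  rw [coeff_timeDer]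
  refine Finset.sum_eq_zero fun n _ => ?_
  rw [hf _ (by omega), map_zero, smul_zero]

theorem coeff_timeDer_congr (c : ℕ → ℚ) (N : ℕ) {f g : LaurentSeries R} {k : ℤ}
    (h : ∀ i < k, f.coeff i = g.coeff i) : (timeDer c N f).coeff k = (timeDer c N g).coeff k := by
  rw [coeff_timeDer, coeff_timeDer]
  refine Finset.sum_congr rfl fun n _ => ?_
  rw [h _ (by omega)]

/-- The operator whose kernel consists, up to order `N`, of the shifts by `c [z⁻¹]`. -/
def flowDer (c : ℚ) (N : ℕ) : Derivation ℚ (LaurentSeries R) (LaurentSeries R) :=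
  euler - timeDer (fun _ => c) N

theorem flowDer_apply (c : ℚ) (N : ℕ) (f : LaurentSeries R) :
    flowDer c N f = euler f - timeDer (fun _ => c) N f := rfl

/-- `F(z)` is a formal power series in `z⁻¹` with `z⁻¹ dF/dz⁻¹ = ∑ c z^{-(2n+1)} ∂F/∂t_{2n+1}`. -/
structure IsFlow (c : ℚ) (F : LaurentSeries R) : Prop where
  regular : IsRegular F
  -- The infinite sum is replaced by its truncations: the coefficient of `z⁻ᵏ` only involves `2n + 1
  -- ≤ k`, hence only `n < N` when `k ≤ N`.
  flow : ∀ (N : ℕ) (k : ℤ), k ≤ N → (flowDer c N F).coeff k = 0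

theorem IsFlow.smul_coeff {c : ℚ} {F : LaurentSeries R} (hF : IsFlow c F) {N : ℕ} {k : ℤ}
    (hk : k ≤ N) :
    k • F.coeff k = ∑ n ∈ Finset.range N, c • pd n (F.coeff (k - (2 * n + 1))) := by
  have := hF.flow N k hk
  rwa [flowDer_apply, HahnSeries.coeff_sub, coeff_euler, coeff_timeDer, sub_eq_zero] at this

theorem isFlow_of_smul_coeff {c : ℚ} {F : LaurentSeries R} (hF : IsRegular F)
    (h : ∀ (N : ℕ) (k : ℤ), k ≤ N →
      k • F.coeff k = ∑ n ∈ Finset.range N, c • pd n (F.coeff (k - (2 * n + 1)))) : IsFlow c F :=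
  ⟨hF, fun N k hk => by
    rw [flowDer_apply, HahnSeries.coeff_sub, coeff_euler, coeff_timeDer, h N k hk, sub_self]⟩

/-- `flowDer` is a derivation. With uniqueness (`IsFlow.ext`) this is what makes the shift
multiplicative without manipulating exponential series. -/
theorem IsFlow.mul {c : ℚ} {F G : LaurentSeries R} (hF : IsFlow c F) (hG : IsFlow c G) :
    IsFlow c (F * G) where
  regular := hF.regular.mul hG.regular
  flow N k hk := by
    rw [Derivation.leibniz, HahnSeries.coeff_add, smul_eq_mul, smul_eq_mul,
      coeff_mul_of_lt (a := 0) (b := N + 1) hF.regular (fun i hi => hG.flow N i (by omega)) (by omega),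
      coeff_mul_of_lt (a := 0) (b := N + 1) hG.regular (fun i hi => hF.flow N i (by omega)) (by omega),
      add_zero]

theorem IsFlow.sub {c : ℚ} {F G : LaurentSeries R} (hF : IsFlow c F) (hG : IsFlow c G) :
    IsFlow c (F - G) where
  regular := hF.regular.sub hG.regular
  flow N k hk := by rw [map_sub, HahnSeries.coeff_sub, hF.flow N k hk, hG.flow N k hk, sub_zero]

theorem IsFlow.add {c : ℚ} {F G : LaurentSeries R} (hF : IsFlow c F) (hG : IsFlow c G) :
    IsFlow c (F + G) where
  regular := hF.regular.add hG.regular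
  flow N k hk := by rw [map_add, HahnSeries.coeff_add, hF.flow N k hk, hG.flow N k hk, add_zero]

/-- The positive coefficients of a flow stay in any subspace which contains the derivatives of the
initial value and is stable under the derivations. -/
theorem IsFlow.coeff_mem {c : ℚ} {F : LaurentSeries R} (hF : IsFlow c F) {M : Submodule ℚ R}
    (h0 : ∀ n, pd n (F.coeff 0) ∈ M) (hM : ∀ n, ∀ x ∈ M, pd n x ∈ M) {k : ℤ} (hk : k ≠ 0) :
    F.coeff k ∈ M := by
  rcases hk.lt_or_gt with hk | hk
  · rw [hF.regular k hk]
    exact zero_mem M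
  · obtain ⟨k, rfl⟩ := Int.eq_ofNat_of_zero_le hk.le
    induction k using Nat.strong_induction_on with
    | _ k ih =>
      have h1 : ((k : ℤ) : ℚ) • F.coeff k ∈ M := by
        rw [Int.cast_smul_eq_zsmul, hF.smul_coeff (N := k) le_rfl]
        refine sum_mem fun n _ => M.smul_mem _ ?_
        rcases lt_trichotomy ((k : ℤ) - (2 * n + 1)) 0 with h | h | h
        · rw [hF.regular _ h, map_zero]
          exact zero_mem M
        · rw [h]
          exact h0 n
        · obtain ⟨j, hj⟩ := Int.eq_ofNat_of_zero_le h.le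
          rw [hj] at h ⊢
          exact hM n _ (ih j (by omega) (by omega) h)
      -- The recursion gives `k F_k`; dividing by `k ≠ 0` uses that `M` is a rational subspace.
      exact (M.smul_mem_iff (by norm_cast; omega)).mp h1

theorem IsFlow.eq_zero {c : ℚ} {F : LaurentSeries R} (hF : IsFlow c F) (h0 : F.coeff 0 = 0) :
    F = 0 := by
  ext k
  by_cases hk : k = 0
  · rw [hk, h0, HahnSeries.coeff_zero]
  · have := hF.coeff_mem (M := ⊥) (by simp [h0]) (by simp) hk
    simpa using this

theorem IsFlow.ext {c : ℚ} {F G : LaurentSeries R} (hF : IsFlow c F) (hG : IsFlow c G)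
    (h : F.coeff 0 = G.coeff 0) : F = G :=
  sub_eq_zero.mp ((hF.sub hG).eq_zero (by rw [HahnSeries.coeff_sub, h, sub_self]))

theorem coeff_shiftGen (c : ℚ) (g : PowerSeries R) {N k : ℕ} (hk : k ≤ N) :
    (HahnSeries.ofPowerSeries ℤ R (shiftGen c g)).coeff (k : ℤ) =
      (timeDer (fun n => c / (2 * n + 1)) N (HahnSeries.ofPowerSeries ℤ R g)).coeff (k : ℤ) := by
  rw [HahnSeries.ofPowerSeries_apply_coeff, coeff_timeDer, shiftGen, PowerSeries.coeff_mk,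
    Finset.sum_filter]
  refine (Finset.sum_subset (Finset.range_subset_range.mpr hk) fun n _ hn => ?_).trans
    (Finset.sum_congr rfl fun n _ => ?_)
  · rw [if_neg]
    rw [Finset.mem_range] at hn
    omega
  · split_ifs with h
    · rw [show (k : ℤ) - (2 * n + 1) = ((k - (2 * n + 1) : ℕ) : ℤ) by omega,
        HahnSeries.ofPowerSeries_apply_coeff]
    · rw [isRegular_ofPowerSeries g _ (by omega), map_zero, smul_zero]

theorem coeff_iterate_shiftGen (c : ℚ) (g : PowerSeries R) {N : ℕ} (m : ℕ) {k : ℤ} (hk : k ≤ N) :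
    (HahnSeries.ofPowerSeries ℤ R ((shiftGen c)^[m] g)).coeff k =
      ((timeDer (fun n => c / (2 * n + 1)) N)^[m] (HahnSeries.ofPowerSeries ℤ R g)).coeff k := by
  induction m generalizing k with
  | zero => rfl
  | succ m ih =>
    rw [Function.iterate_succ_apply', Function.iterate_succ_apply',
      coeff_timeDer_congr _ _ (k := k) fun i hi => (ih (k := i) (by omega)).symm]
    by_cases h : k < 0
    · rw [isRegular_ofPowerSeries _ k h,
        coeff_timeDer_of_lt _ _ (m := 0) (isRegular_ofPowerSeries _) (by omega)]
    · obtain ⟨j, rfl⟩ := Int.eq_ofNat_of_zero_le (not_lt.mp h)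
      exact coeff_shiftGen c _ (by omega)

theorem coeff_iterate_timeDer_of_lt (c : ℕ → ℚ) (N : ℕ) {f : LaurentSeries R} (hf : IsRegular f)
    (m : ℕ) {k : ℤ} (hk : k < m) : ((timeDer c N)^[m] f).coeff k = 0 := by
  induction m generalizing k with
  | zero => exact hf k (by simpa using hk)
  | succ m ih =>
    rw [Function.iterate_succ_apply']
    exact coeff_timeDer_of_lt c N (m := m) (fun i hi => ih hi) (by push_cast at hk; omega)

/-- The commutator of `euler` with `D = ∑ c/(2n+1) z^{-(2n+1)} ∂/∂t_{2n+1}` is `D' = ∑ c z^{-(2n+1)}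
∂/∂t_{2n+1}`, which commutes with `D`. Hence `D^{m+1}` differentiates like an ordinary power. -/
theorem euler_iterate_timeDer (c : ℚ) (N : ℕ) {f : LaurentSeries R} (hf : euler f = 0) (m : ℕ) :
    euler ((timeDer (fun n => c / (2 * n + 1)) N)^[m + 1] f) =
      (m + 1) • timeDer (fun _ => c) N ((timeDer (fun n => c / (2 * n + 1)) N)^[m] f) := by
  induction m with
  | zero =>
    rw [Function.iterate_one, euler_timeDer, hf, map_zero, zero_add, zero_add, one_smul]
    rfl
  | succ m ih =>
    rw [Function.iterate_succ_apply', euler_timeDer, ih, map_nsmul, timeDer_comm,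
      ← Function.iterate_succ_apply' (f := timeDer (fun n => c / (2 * n + 1)) N)]
    rw [succ_nsmul _ (m + 1)]

/-- Each application of the exponent raises the order in `z⁻¹` by at least one, so up to `z^{-N}`
the exponential is a finite sum of powers of a genuine derivation. -/
theorem coeff_shift (c : ℚ) (f : R) {N : ℕ} {k : ℤ} (hk : k ≤ N) : (shift c f).coeff k =
    (∑ m ∈ Finset.range (N + 1), ((1 : ℚ) / m.factorial) •
      (timeDer (fun n => c / (2 * n + 1)) N)^[m] (HahnSeries.C f)).coeff k := by
  have hC : HahnSeries.ofPowerSeries ℤ R (PowerSeries.C f) = HahnSeries.C f := by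
    rw [HahnSeries.ofPowerSeries_C]
  rw [HahnSeries.coeff_sum]
  simp only [HahnSeries.coeff_smul]
  by_cases h : k < 0
  · rw [shift, isRegular_ofPowerSeries _ k h]
    refine (Finset.sum_eq_zero fun m _ => ?_).symm
    rw [coeff_iterate_timeDer_of_lt _ _ (isRegular_C f) m (by omega), smul_zero]
  · obtain ⟨j, rfl⟩ := Int.eq_ofNat_of_zero_le (not_lt.mp h)
    rw [shift, HahnSeries.ofPowerSeries_apply_coeff, PowerSeries.coeff_mk]
    refine (Finset.sum_congr rfl fun m _ => ?_).trans (Finset.sum_subset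
      (Finset.range_subset_range.mpr (by omega : j + 1 ≤ N + 1)) fun m _ hm => ?_)
    · rw [← HahnSeries.ofPowerSeries_apply_coeff (Γ := ℤ), ← hC]
      congr 1
      exact coeff_iterate_shiftGen c _ m hk
    · rw [Finset.mem_range] at hm
      rw [coeff_iterate_timeDer_of_lt _ _ (isRegular_C f) m (by omega), smul_zero]

theorem isFlow_shift (c : ℚ) (f : R) : IsFlow c (shift c f) where
  regular := isRegular_ofPowerSeries _
  flow N k hk := by
    have h0 : euler (HahnSeries.C f : LaurentSeries R) = 0 := by
      rw [HahnSeries.C_apply, euler_single, zero_smul]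
    rw [flowDer_apply, HahnSeries.coeff_sub, coeff_euler, coeff_shift c f hk, ← coeff_euler,
      coeff_timeDer_congr _ _ (k := k) fun i hi => coeff_shift c f (N := N) (by omega)]
    rw [map_sum, Finset.sum_range_succ', Finset.sum_range_succ (n := N), map_add,
      HahnSeries.coeff_add, HahnSeries.coeff_add]
    simp only [map_rat_smul, euler_iterate_timeDer c N h0, map_sum]
    -- The two sums match term by term after an index shift. The unmatched ends vanish: the initial
    -- value is constant in `z`, and the last term has order at least `N + 1 > k`.
    rw [HahnSeries.coeff_smul, HahnSeries.coeff_smul, coeff_timeDer_of_lt (m := N), smul_zero,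
      add_zero, Function.iterate_zero, id, h0, HahnSeries.coeff_zero, smul_zero, add_zero,
      sub_eq_zero]
    · congr 1
      refine Finset.sum_congr rfl fun m _ => ?_
      rw [← Nat.cast_smul_eq_nsmul ℚ, smul_smul]
      congr 1
      rw [Nat.factorial_succ]
      push_cast
      have h1 : (m + 1 : ℚ) ≠ 0 := by positivity
      have h2 : (m.factorial : ℚ) ≠ 0 := by positivity
      field_simp
    · exact fun i hi => coeff_iterate_timeDer_of_lt _ _ (isRegular_C f) N hi
    · omega

theorem coeff_zero_shift (c : ℚ) (f : R) : (shift c f).coeff 0 = f := by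
  rw [coeff_shift c f (N := 0) (by simp)]
  simp

theorem isRegular_shift (c : ℚ) (f : R) : IsRegular (shift c f) := (isFlow_shift c f).regular

theorem IsFlow.eq_shift {c : ℚ} {F : LaurentSeries R} (hF : IsFlow c F) :
    F = shift c (F.coeff 0) :=
  hF.ext (isFlow_shift _ _) (coeff_zero_shift _ _).symm

theorem isFlow_one (c : ℚ) : IsFlow c (1 : LaurentSeries R) where
  regular := by rw [← map_one HahnSeries.C]; exact isRegular_C 1
  flow N k _ := by rw [Derivation.map_one_eq_zero, HahnSeries.coeff_zero]

/-- The shift of the times is a ring homomorphism. -/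
def shiftHom (c : ℚ) : R →+* LaurentSeries R where
  toFun := shift c
  map_one' := by
    have h := (isFlow_one (R := R) c).eq_shift
    rw [HahnSeries.coeff_one, if_pos rfl] at h
    exact h.symm
  map_mul' f g := by
    have h := ((isFlow_shift c f).mul (isFlow_shift c g)).eq_shift
    rw [coeff_zero_mul (isRegular_shift c f) (isRegular_shift c g), coeff_zero_shift,
      coeff_zero_shift] at h
    exact h.symm
  map_zero' := by
    refine IsFlow.eq_zero (isFlow_shift c 0) (coeff_zero_shift c 0)
  map_add' f g := by
    have h := ((isFlow_shift c f).add (isFlow_shift c g)).eq_shift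
    rw [HahnSeries.coeff_add, coeff_zero_shift, coeff_zero_shift] at h
    exact h.symm

@[simp] theorem shiftHom_apply (c : ℚ) (f : R) : shiftHom c f = shift c f := rfl

theorem shift_mul (c : ℚ) (f g : R) : shift c (f * g) = shift c f * shift c g :=
  map_mul (shiftHom c) f g

theorem shift_one (c : ℚ) : shift c (1 : R) = 1 := by
  rw [← shiftHom_apply, map_one]

/-- The flow equation involves only addition and the derivations. Asking `φ` merely to be additive
allows it to be a derivation or a coefficient functional as well as a ring homomorphism. -/
theorem shift_natural {R' : Type*} [CommRing R'] [Algebra ℚ R'] [TimeAlgebra R'] (φ : R →+ R')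
    (hφ : ∀ n x, φ (pd n x) = pd n (φ x)) (c : ℚ) (f : R) :
    shift c (φ f) = (shift c f).map φ := by
  have h : IsFlow c ((shift c f).map φ) := isFlow_of_smul_coeff (fun i hi => by
    rw [HahnSeries.map_coeff, isRegular_shift c f i hi, map_zero]) fun N k hk => by
      rw [HahnSeries.map_coeff, ← map_zsmul, (isFlow_shift c f).smul_coeff hk, map_sum]
      refine Finset.sum_congr rfl fun n _ => ?_
      rw [map_rat_smul, hφ, HahnSeries.map_coeff]
  rw [h.eq_shift, HahnSeries.map_coeff, coeff_zero_shift]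

theorem shift_pd (c : ℚ) (n : ℕ) (f : R) : shift c (pd n f) = pd n (shift c f) := by
  have h := shift_natural ((pd n : Derivation ℚ R R) : R →+ R) (fun m x => pd_comm n m x) c f
  exact h

/-- Only odd powers of `z⁻¹` occur in the exponent, so changing the sign of the shift is the
substitution `z ↦ -z`. -/
theorem shift_neg (c : ℚ) (f : R) : shift (-c) f = negSpec (shift c f) := by
  have h : IsFlow (-c) (negSpec (shift c f)) := isFlow_of_smul_coeff (fun i hi => by
    rw [coeff_negSpec, isRegular_shift c f i hi, smul_zero]) fun N k hk => by
      rw [coeff_negSpec, smul_comm, (isFlow_shift c f).smul_coeff hk, Finset.smul_sum]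
      refine Finset.sum_congr rfl fun n _ => ?_
      rw [coeff_negSpec, Int.negOnePow_sub, Int.negOnePow_odd (2 * n + 1) ⟨n, rfl⟩, map_zsmul]
      simp only [mul_neg, mul_one, Units.val_neg, neg_smul, smul_neg, neg_neg]
      rw [smul_comm]
  rw [h.eq_shift, coeff_negSpec, coeff_zero_shift, Int.negOnePow_zero, Units.val_one, one_smul]

/-- The shift of an exponential: `e^{ξ(t - 2[z⁻¹], μ)} = (z - μ)/(z + μ) e^{ξ(t,μ)}`. -/
theorem add_mul_shift_exp {m e : R} (hm : ∀ n, pd n m = 0)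
    (he : ∀ n, pd n e = m ^ (2 * n + 1) * e) :
    (spec R + HahnSeries.C m) * shift (-2) e = (spec R - HahnSeries.C m) * HahnSeries.C e := by
  -- Here `y = μ/z`. The candidate for the shifted exponential is `(1 - y)(1 + y)⁻¹ e`, and `a'` is
  -- the inverse of `1 + y`.
  set y : LaurentSeries R := HahnSeries.single 1 m with hy
  have hyr : IsRegular y := fun i hi => HahnSeries.coeff_single_of_ne (by omega)
  obtain ⟨a', ha', haa'⟩ : ∃ a' : LaurentSeries R, IsRegular a' ∧ (1 + y) * a' = 1 := by
    have hu : IsUnit (1 + PowerSeries.C m * PowerSeries.X : PowerSeries R) := by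
      rw [PowerSeries.isUnit_iff_constantCoeff]
      simp
    obtain ⟨b, hb⟩ := hu.exists_right_inv
    refine ⟨HahnSeries.ofPowerSeries ℤ R b, isRegular_ofPowerSeries b, ?_⟩
    have h := congrArg (HahnSeries.ofPowerSeries ℤ R) hb
    rw [map_mul, map_add, map_one, map_mul, HahnSeries.ofPowerSeries_C, HahnSeries.ofPowerSeries_X,
      HahnSeries.C_apply, HahnSeries.single_mul_single, zero_add, mul_one] at h
    exact h
  have hone : IsRegular (1 : LaurentSeries R) := (isFlow_one 0).regular
  have hF : IsFlow (-2) ((1 - y) * HahnSeries.C e * a') := by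
    refine ⟨((hone.sub hyr).mul (isRegular_C e)).mul ha', fun N k hk => ?_⟩
    set δ : Derivation ℚ (LaurentSeries R) (LaurentSeries R) := flowDer (-2) N with hδ
    have hδy : δ y = y := by
      rw [hδ, flowDer_apply, euler_single, one_smul, sub_eq_self, timeDer_apply]
      refine Finset.sum_eq_zero fun n _ => ?_
      rw [show pd n y = 0 from ?_, mul_zero]
      ext i
      rw [coeff_pd]
      by_cases hi : i = 1
      · rw [hi, hy, HahnSeries.coeff_single_same, hm, HahnSeries.coeff_zero]
      · rw [hy, HahnSeries.coeff_single_of_ne hi, map_zero, HahnSeries.coeff_zero]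
    have hδe : δ (HahnSeries.C e) = 2 * (∑ n ∈ Finset.range N, y ^ (2 * n + 1)) * HahnSeries.C e := by
      rw [flowDer_apply, HahnSeries.C_apply, euler_single, zero_smul, zero_sub, timeDer_apply,
        Finset.mul_sum, Finset.sum_mul, ← Finset.sum_neg_distrib]
      refine Finset.sum_congr rfl fun n _ => ?_
      rw [← HahnSeries.C_apply, pd_C, he, hy, HahnSeries.single_pow, single_eq_C_mul,
        single_eq_C_mul (_ • _)]
      simp only [map_mul, map_neg, map_ofNat, nsmul_eq_mul, mul_one]
      push_cast
      ring
    have hgeom : (1 - y ^ 2) * ∑ n ∈ Finset.range N, y ^ (2 * n + 1) = y - y ^ (2 * N + 1) := by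
      clear hk hδe hδy hδ δ
      induction N with
      | zero => simp
      | succ N ih => rw [Finset.sum_range_succ, mul_add, ih]; ring
    have hδa : δ a' * (1 + y) + a' * y = 0 := by
      have := congrArg δ haa'
      rw [Derivation.leibniz, map_add, Derivation.map_one_eq_zero, hδy, zero_add, smul_eq_mul,
        smul_eq_mul] at this
      linear_combination this
    -- The logarithmic derivative `-2y/(1 - y²)` of `(1 - y)/(1 + y)` cancels the geometric series
    -- coming from `e`; truncating at `N` leaves an error divisible by `y^{2N+1}`.
    have hδF : δ ((1 - y) * HahnSeries.C e * a') =
        y ^ (2 * N + 1) * (-2 * HahnSeries.C e * a' * a') := by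
      simp only [Derivation.leibniz, map_sub, Derivation.map_one_eq_zero, hδy, hδe, smul_eq_mul]
      have e1 : δ a' = -y * a' ^ 2 := by linear_combination a' * hδa - δ a' * haa'
      have e2 : (1 - y) * ∑ n ∈ Finset.range N, y ^ (2 * n + 1) = (y - y ^ (2 * N + 1)) * a' := by
        linear_combination a' * hgeom -
          (1 - y) * (∑ n ∈ Finset.range N, y ^ (2 * n + 1)) * haa'
      linear_combination 2 * HahnSeries.C e * a' * e2 + (1 - y) * HahnSeries.C e * e1 +
        y * HahnSeries.C e * a' * haa'
    rw [hδF]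
    refine coeff_mul_of_lt (a := 2 * N + 1) (b := 0) ?_ ?_ (by omega)
    · intro i hi
      rw [hy, HahnSeries.single_pow, HahnSeries.coeff_single_of_ne]
      simp
      omega
    · have h2 : (-2 : LaurentSeries R) = HahnSeries.C (-2) := by rw [map_neg, map_ofNat]
      rw [h2]
      exact (((isRegular_C _).mul (isRegular_C e)).mul ha').mul ha'
  have h0 : ((1 - y) * HahnSeries.C e * a').coeff 0 = e := by
    have h3 := congrArg (fun f : LaurentSeries R => f.coeff 0) haa'
    have hy0 : y.coeff 0 = 0 := HahnSeries.coeff_single_of_ne (by norm_num)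
    have h1c : (1 : LaurentSeries R).coeff 0 = 1 := by simp
    simp only [coeff_zero_mul (hone.add hyr) ha', HahnSeries.coeff_add, hy0, h1c, add_zero,
      one_mul] at h3
    rw [coeff_zero_mul ((hone.sub hyr).mul (isRegular_C e)) ha',
      coeff_zero_mul (hone.sub hyr) (isRegular_C e), HahnSeries.coeff_sub, hy0, h1c, h3]
    simp
  have h1 := hF.eq_shift
  rw [h0] at h1
  rw [← h1]
  have h2 : spec R * y = HahnSeries.C m := by
    rw [spec, hy, HahnSeries.single_mul_single, one_mul, neg_add_cancel, HahnSeries.C_apply]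
  linear_combination spec R * (1 - y) * HahnSeries.C e * haa' -
    ((1 - y) * HahnSeries.C e * a' + HahnSeries.C e) * h2

end Flow

/-! ### Change of coefficients and the inclusions into rings of wave functions -/

section LaurentMap

variable {R S : Type*} [CommRing R] [CommRing S]

/-- A ring homomorphism applied to the coefficients of a Laurent series. -/
def laurentMap (φ : R →+* S) : LaurentSeries R →+* LaurentSeries S where
  toFun f := f.map φ
  map_one' := by
    rw [← map_one HahnSeries.C, HahnSeries.map_C, map_one, map_one]
  map_mul' f g := by
    obtain ⟨a, ha⟩ := PDO.exists_bound f
    obtain ⟨b, hb⟩ := PDO.exists_bound g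
    ext n
    rw [HahnSeries.map_coeff, coeff_mul_eq_sum ha hb, coeff_mul_eq_sum (a := a) (b := b)
      (fun i hi => by rw [HahnSeries.map_coeff, ha i hi, map_zero])
      (fun i hi => by rw [HahnSeries.map_coeff, hb i hi, map_zero]), map_sum]
    simp only [map_mul, HahnSeries.map_coeff]
  map_zero' := by ext n; simp
  map_add' f g := by ext n; simp

theorem laurentMap_apply (φ : R →+* S) (f : LaurentSeries R) : laurentMap φ f = f.map φ := rfl

@[simp] theorem coeff_laurentMap (φ : R →+* S) (f : LaurentSeries R) (n : ℤ) :
    (laurentMap φ f).coeff n = φ (f.coeff n) := rfl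

theorem laurentMap_C (φ : R →+* S) (a : R) :
    laurentMap φ (HahnSeries.C a) = HahnSeries.C (φ a) := HahnSeries.map_C a φ

theorem laurentMap_spec (φ : R →+* S) : laurentMap φ (spec R) = spec S := by
  ext n
  rw [coeff_laurentMap, spec, spec]
  by_cases h : n = -1
  · rw [h, HahnSeries.coeff_single_same, HahnSeries.coeff_single_same, map_one]
  · rw [HahnSeries.coeff_single_of_ne h, HahnSeries.coeff_single_of_ne h, map_zero]

theorem laurentMap_laurentMap {T : Type*} [CommRing T] (ψ : S →+* T) (φ : R →+* S)
    (f : LaurentSeries R) : laurentMap ψ (laurentMap φ f) = laurentMap (ψ.comp φ) f := by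
  ext n; rfl

theorem laurentMap_pd [Algebra ℚ R] [TimeAlgebra R] [Algebra ℚ S] [TimeAlgebra S] {φ : R →+* S}
    (hφ : ∀ n x, φ (pd n x) = pd n (φ x)) (n : ℕ) (f : LaurentSeries R) :
    laurentMap φ (pd n f) = pd n (laurentMap φ f) := by
  ext i
  exact hφ n _

theorem shift_map [Algebra ℚ R] [TimeAlgebra R] [Algebra ℚ S] [TimeAlgebra S] {φ : R →+* S}
    (hφ : ∀ n x, φ (pd n x) = pd n (φ x)) (c : ℚ) (f : R) :
    shift c (φ f) = laurentMap φ (shift c f) :=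
  shift_natural (φ : R →+ S) hφ c f

end LaurentMap

section Inclusions

variable {R : Type*} [CommRing R]

theorem const_apply (a : R) : (const a : BA R) = LaurentPolynomial.C (HahnSeries.C a) := rfl

theorem applyExp_injective : Function.Injective (applyExp : LaurentSeries R → BA R) := by
  intro f g h
  have h1 := congrArg (· * (T (-1) : BA R)) h
  simp only [applyExp, mul_assoc, ← T_add] at h1
  norm_num at h1
  simpa using congrArg (fun x : BA R => x.coeff 0) h1

theorem coeff_coeff_C (f : LaurentSeries R) (k n : ℤ) :
    ((HahnSeries.C f : LaurentSeries (LaurentSeries R)).coeff k).coeff n =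
      (HahnSeries.C (f.coeff n) : LaurentSeries R).coeff k := by
  rw [HahnSeries.C_apply, HahnSeries.C_apply]
  by_cases hk : k = 0
  · rw [hk, HahnSeries.coeff_single_same, HahnSeries.coeff_single_same]
  · rw [HahnSeries.coeff_single_of_ne hk, HahnSeries.coeff_single_of_ne hk, HahnSeries.coeff_zero]

theorem algebraMap_BA [Algebra ℚ R] (q : ℚ) : algebraMap ℚ (BA R) q = const (algebraMap ℚ R q) :=
  RingHom.congr_fun (RingHom.ext_rat (algebraMap ℚ (BA R)) (const.comp (algebraMap ℚ R))) q

variable [Algebra ℚ R] [TimeAlgebra R]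

theorem pd_C_mul_T (n : ℕ) (f : LaurentSeries R) (k : ℤ) :
    pd n (LaurentPolynomial.C f * T k : BA R) =
      LaurentPolynomial.C (pd n f + k * spec R ^ (2 * n + 1) * f) * T k :=
  expDer_C_mul_T _ _ k f

theorem C_pd (n : ℕ) (f : LaurentSeries R) :
    (LaurentPolynomial.C (pd n f) : BA R) = pd n (LaurentPolynomial.C f : BA R) := by
  have h := pd_C_mul_T n f 0
  rw [T_zero, mul_one, mul_one, Int.cast_zero, zero_mul, zero_mul, add_zero] at h
  exact h.symm

theorem const_pd (n : ℕ) (a : R) : (const (pd n a) : BA R) = pd n (const a) := by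
  rw [const_apply, ← pd_C, C_pd, ← const_apply]

theorem pd_applyExp (n : ℕ) (f : LaurentSeries R) : pd n (applyExp f) = applyExp (tsym n f) := by
  rw [applyExp, pd_C_mul_T, Int.cast_one, one_mul]
  rfl

end Inclusions

/-! ### Orders in `μ` of double series, and spaces of functions `h(μ) e^{ξ(t,μ)}` -/

section DoubleSeries

variable {R : Type*} [CommRing R]

/-- Double series in `z` and `μ` which contain only powers `μ⁻ⁿ` with `n ≥ j`. -/
def VanishesBelow (j : ℤ) (f : LaurentSeries (LaurentSeries R)) : Prop :=
  ∀ k, ∀ n < j, (f.coeff k).coeff n = 0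

namespace VanishesBelow

variable {i j : ℤ} {f g : LaurentSeries (LaurentSeries R)}

theorem add (hf : VanishesBelow j f) (hg : VanishesBelow j g) : VanishesBelow j (f + g) :=
  fun k n hn => by rw [HahnSeries.coeff_add, HahnSeries.coeff_add, hf k n hn, hg k n hn, add_zero]

theorem sub (hf : VanishesBelow j f) (hg : VanishesBelow j g) : VanishesBelow j (f - g) :=
  fun k n hn => by rw [HahnSeries.coeff_sub, HahnSeries.coeff_sub, hf k n hn, hg k n hn, sub_zero]

theorem mono (hf : VanishesBelow j f) (h : i ≤ j) : VanishesBelow i f :=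
  fun k n hn => hf k n (hn.trans_le h)

theorem mul (hf : VanishesBelow i f) (hg : VanishesBelow j g) : VanishesBelow (i + j) (f * g) := by
  intro k n hn
  obtain ⟨a, ha⟩ := PDO.exists_bound f
  obtain ⟨b, hb⟩ := PDO.exists_bound g
  rw [coeff_mul_eq_sum ha hb, HahnSeries.coeff_sum]
  exact Finset.sum_eq_zero fun l _ => coeff_mul_of_lt (hf l) (hg (k - l)) hn

theorem const {x : LaurentSeries R} (hx : ∀ n < j, x.coeff n = 0) :
    VanishesBelow j (HahnSeries.C x) := by
  intro k n hn
  rw [HahnSeries.C_apply]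
  by_cases hk : k = 0
  · rw [hk, HahnSeries.coeff_single_same, hx n hn]
  · rw [HahnSeries.coeff_single_of_ne hk, HahnSeries.coeff_zero]

theorem laurentMap_C (f : LaurentSeries R) : VanishesBelow 0 (laurentMap HahnSeries.C f) :=
  fun k n hn => by rw [coeff_laurentMap, isRegular_C _ n hn]

theorem spec : VanishesBelow 0 (spec (LaurentSeries R)) := by
  rw [← laurentMap_spec HahnSeries.C]
  exact laurentMap_C _

end VanishesBelow

end DoubleSeries

section ExpSpan

variable {A : Type*} [CommRing A] [Algebra ℚ A]

/-- The functions `h(μ) e^{ξ(t,μ)}` with `h` in a given space of series. -/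
def expSpan (M : Submodule A (LaurentSeries A)) : Submodule ℚ (BA A) where
  carrier := {x | ∃ h ∈ M, applyExp h = x}
  add_mem' := by
    rintro _ _ ⟨f, hf, rfl⟩ ⟨g, hg, rfl⟩
    exact ⟨f + g, add_mem hf hg, by simp only [applyExp, map_add, add_mul]⟩
  zero_mem' := ⟨0, zero_mem _, by simp [applyExp]⟩
  smul_mem' := by
    rintro q _ ⟨f, hf, rfl⟩
    refine ⟨(algebraMap ℚ A q) • f, M.smul_mem _ hf, ?_⟩
    rw [Algebra.smul_def, algebraMap_BA, const_apply, applyExp, applyExp,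
      ← HahnSeries.C_mul_eq_smul, map_mul, mul_assoc]

theorem const_mul_mem_expSpan {M : Submodule A (LaurentSeries A)} (a : A) {x : BA A}
    (hx : x ∈ expSpan M) : const a * x ∈ expSpan M := by
  obtain ⟨f, hf, rfl⟩ := hx
  refine ⟨a • f, M.smul_mem _ hf, ?_⟩
  rw [const_apply, applyExp, applyExp, ← HahnSeries.C_mul_eq_smul, map_mul, mul_assoc]

end ExpSpan

/-! ### The exchange relation -/

section Exchange

variable {A : Type*} [CommRing A] [Algebra ℚ A] [TimeAlgebra A] {L W : PDO A} {τ : Aˣ}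

theorem IsDressing.pd_mem_expSpan (hW : IsDressing L W) (n : ℕ) {x : BA A}
    (hx : x ∈ expSpan (waveSpan W)) : pd n x ∈ expSpan (waveSpan W) := by
  obtain ⟨f, hf, rfl⟩ := hx
  exact ⟨tsym n f, hW.tsym_mem_waveSpan_of_mem n hf, (pd_applyExp n f).symm⟩

theorem IsDressing.pd_applyExp_mem (hW : IsDressing L W) (n : ℕ) :
    pd n (applyExp W) ∈ expSpan (waveSpan W) :=
  ⟨tsym n W, hW.tsym_mem_waveSpan n, (pd_applyExp n W).symm⟩

/-- The wave function itself need not lie in the span, but its time derivatives do, and they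
generate all later coefficients of the shift. Subtracting the constant term is therefore essential.
-/
theorem IsDressing.coeff_shift_sub_mem (hW : IsDressing L W) (c : ℚ) (k : ℤ) :
    (shift c (applyExp W) - HahnSeries.C (applyExp W)).coeff k ∈ expSpan (waveSpan W) := by
  rw [HahnSeries.coeff_sub, HahnSeries.C_apply]
  by_cases hk : k = 0
  · rw [hk, coeff_zero_shift, HahnSeries.coeff_single_same, sub_self]
    exact zero_mem _
  · rw [HahnSeries.coeff_single_of_ne hk, sub_zero]
    refine (isFlow_shift c (applyExp W)).coeff_mem (fun n => ?_)
      (fun n x hx => hW.pd_mem_expSpan n hx) hk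
    rw [coeff_zero_shift]
    exact hW.pd_applyExp_mem n

/-- The logarithmic derivative `∂ log τ`. -/
def logDer (τ : Aˣ) : A := pd 0 (τ : A) * (↑τ⁻¹ : A)

theorem pd_inv (n : ℕ) (τ : Aˣ) :
    pd n (↑τ⁻¹ : A) = -(pd n (τ : A) * (↑τ⁻¹ : A) * (↑τ⁻¹ : A)) := by
  have h := congrArg (pd n : Derivation ℚ A A) τ.mul_inv
  rw [Derivation.leibniz, Derivation.map_one_eq_zero, smul_eq_mul, smul_eq_mul] at h
  have h1 := τ.mul_inv
  linear_combination (↑τ⁻¹ : A) * h - pd n (↑τ⁻¹ : A) * h1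

/-- `∂ψ(t,z) = (z + Δ_z ∂ log τ) ψ(t,z)`. -/
theorem IsTau.dsym_eq (hτ : IsTau W τ) : dsym W = (spec A + shiftDiff (logDer τ)) * W := by
  have h1 : shift (-2) (τ : A) * shift (-2) (↑τ⁻¹ : A) = 1 := by
    rw [← shift_mul, τ.mul_inv, shift_one]
  have h2 : (HahnSeries.C (τ : A) : LaurentSeries A) * HahnSeries.C (↑τ⁻¹ : A) = 1 := by
    rw [← map_mul, τ.mul_inv, map_one]
  rw [dsym_apply, shiftDiff, logDer, hτ, Derivation.leibniz, smul_eq_mul, smul_eq_mul, pd_C, pd_inv,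
    ← shift_pd, shift_mul]
  simp only [map_mul, map_neg]
  linear_combination -(shift (-2) (pd 0 (τ : A)) * HahnSeries.C (↑τ⁻¹ : A)) * h1

/-- The flow equation for `τ(t - 2[z⁻¹])` at order `z⁻¹`. -/
theorem IsTau.coeff_one (hτ : IsTau W τ) : W.coeff 1 = -2 * logDer τ := by
  have h := (isFlow_shift (-2) (τ : A)).smul_coeff (N := 1) (k := 1) (by simp)
  rw [Finset.sum_range_one] at h
  norm_num [coeff_zero_shift] at h
  rw [hτ, mul_comm, HahnSeries.C_mul_eq_smul, HahnSeries.coeff_smul, h, logDer, smul_eq_mul,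
    Algebra.smul_def, map_ofNat]
  ring

/-- Time derivatives act coefficientwise on series in `μ`, so extracting a coefficient commutes with
them and `shift_natural` applies. -/
theorem coeff_coeff_shift (c : ℚ) (f : LaurentSeries A) (k n : ℤ) :
    ((shift c f).coeff k).coeff n = (shift c (f.coeff n)).coeff k := by
  have h := shift_natural (R := LaurentSeries A) (R' := A)
    { toFun := fun f => f.coeff n, map_zero' := rfl, map_add' := fun _ _ => rfl }
    (fun _ _ => rfl) c f
  exact (congrArg (fun g : LaurentSeries A => g.coeff k) h).symm

theorem coeff_coeff_shiftDiff (f : LaurentSeries A) (k n : ℤ) :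
    ((shiftDiff f).coeff k).coeff n = (shiftDiff (f.coeff n)).coeff k := by
  rw [shiftDiff, shiftDiff, HahnSeries.coeff_sub, HahnSeries.coeff_sub, HahnSeries.coeff_sub,
    coeff_coeff_shift, coeff_coeff_C]

theorem shiftDiff_one : shiftDiff (1 : A) = 0 := by
  rw [shiftDiff, shift_one, map_one, sub_self]

theorem shiftDiff_zero : shiftDiff (0 : A) = 0 := by
  rw [shiftDiff, ← shiftHom_apply, map_zero, map_zero, sub_self]

theorem shiftDiff_neg_two_mul (a : A) : shiftDiff (-2 * a) = -2 * shiftDiff a := by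
  rw [shiftDiff, shiftDiff, ← shiftHom_apply, map_mul, map_mul, map_neg, map_neg, map_ofNat,
    map_ofNat, shiftHom_apply]
  ring

theorem IsDressing.vanishesBelow_shiftDiff (hW : IsDressing L W) :
    VanishesBelow 1 (shiftDiff W) := by
  intro k n hn
  rw [coeff_coeff_shiftDiff]
  rcases (Int.lt_add_one_iff.mp hn : n ≤ 0).lt_or_eq with h | h
  · rw [hW.coeff_neg n h, shiftDiff_zero, HahnSeries.coeff_zero]
  · rw [h, hW.coeff_zero, shiftDiff_one, HahnSeries.coeff_zero]

theorem IsDressing.vanishesBelow_pd_C (hW : IsDressing L W) (m : ℕ) :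
    VanishesBelow 1 (pd m (HahnSeries.C W : LaurentSeries (LaurentSeries A))) := by
  intro k n hn
  rw [coeff_pd, coeff_pd, coeff_coeff_C]
  rcases (Int.lt_add_one_iff.mp hn : n ≤ 0).lt_or_eq with h | h
  · rw [hW.coeff_neg n h, map_zero, HahnSeries.coeff_zero, map_zero]
  · rw [h, hW.coeff_zero, ← coeff_pd, map_one, Derivation.map_one_eq_zero, HahnSeries.coeff_zero]

theorem VanishesBelow.pd {j : ℤ} {f : LaurentSeries (LaurentSeries A)} (hf : VanishesBelow j f)
    (m : ℕ) : VanishesBelow j (pd m f) := fun k n hn => by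
  rw [coeff_pd, coeff_pd, hf k n hn, map_zero]

/-- `Δ_z W` starts with `Δ_z w₁ μ⁻¹`, and `w₁ = -2 ∂ log τ` makes the second summand cancel exactly
this term. -/
theorem IsDressing.vanishesBelow_shiftDiff_add (hW : IsDressing L W) (hτ : IsTau W τ) :
    VanishesBelow 2 (shiftDiff W + 2 * laurentMap HahnSeries.C (shiftDiff (logDer τ)) *
      HahnSeries.C (HahnSeries.single 1 1)) := by
  have h2 : VanishesBelow 1 (2 * laurentMap HahnSeries.C (shiftDiff (logDer τ)) *
      HahnSeries.C (HahnSeries.single (1 : ℤ) (1 : A))) := by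
    rw [show (2 : LaurentSeries (LaurentSeries A)) = laurentMap HahnSeries.C 2 by rw [map_ofNat],
      ← map_mul]
    exact (VanishesBelow.laurentMap_C _).mul (VanishesBelow.const (j := 1) fun n hn =>
      HahnSeries.coeff_single_of_ne hn.ne)
  intro k n hn
  by_cases h : n = 1
  · rw [h, HahnSeries.coeff_add, HahnSeries.coeff_add, coeff_coeff_shiftDiff, hτ.coeff_one,
      shiftDiff_neg_two_mul, mul_comm _ (HahnSeries.C _), HahnSeries.C_mul_eq_smul,
      HahnSeries.coeff_smul, smul_eq_mul, HahnSeries.coeff_single_mul, sub_self, one_mul,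
      show (2 : LaurentSeries (LaurentSeries A)) = laurentMap HahnSeries.C 2 by rw [map_ofNat],
      ← map_mul, coeff_laurentMap, HahnSeries.C_apply, HahnSeries.coeff_single_same, neg_mul,
      HahnSeries.coeff_neg, neg_add_cancel]
  · exact (hW.vanishesBelow_shiftDiff.add h2) k n (by omega)

end Exchange

section Exchange

variable {A : Type*} [CommRing A] [Algebra ℚ A] [TimeAlgebra A] {L W : PDO A} {τ : Aˣ}

/-- `(z + μ) e^{-ξ(t,μ)}` times the left hand side minus the right hand side of
`(∂ + a) ψ(t - 2[z⁻¹],μ) = -(∂ - a) ψ(t,μ)`, where `a = z + Δ_z ∂ log τ`. -/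
def exchangeDefect (W : PDO A) (τ : Aˣ) : LaurentSeries (LaurentSeries A) :=
  (spec _ + laurentMap HahnSeries.C (shiftDiff (logDer τ))) * spec _ * shiftDiff W +
    spec _ * (pd 0 (shift (-2) W) + pd 0 (HahnSeries.C W)) -
    HahnSeries.C (spec A) * (pd 0 (shift (-2) W) - pd 0 (HahnSeries.C W)) -
    -- The terms are grouped so that each is visibly regular in `μ`: the summand `-2 μ Δ_z ∂ log τ`
    -- is moved here as `-μ² · 2 Δ_z ∂ log τ · μ⁻¹`, which leaves `W - 1` in place of `W` in the
    -- last term.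
    HahnSeries.C (spec A) * HahnSeries.C (spec A) * (shiftDiff W +
      2 * laurentMap HahnSeries.C (shiftDiff (logDer τ)) * HahnSeries.C (HahnSeries.single 1 1)) -
    HahnSeries.C (spec A) * laurentMap HahnSeries.C (shiftDiff (logDer τ)) *
      (shiftDiff W + 2 * HahnSeries.C (W - 1))

theorem vanishesBelow_exchangeDefect (hW : IsDressing L W) (hτ : IsTau W τ) :
    VanishesBelow 0 (exchangeDefect W τ) := by
  have hμ : VanishesBelow (-1) (HahnSeries.C (spec A)) :=
    VanishesBelow.const fun n hn => HahnSeries.coeff_single_of_ne hn.ne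
  have hz : VanishesBelow 0 (spec (LaurentSeries A)) := VanishesBelow.spec
  have hα := VanishesBelow.laurentMap_C (shiftDiff (logDer τ))
  have hW1 : VanishesBelow 1 (HahnSeries.C (W - 1)) := VanishesBelow.const fun n hn => by
    rw [HahnSeries.coeff_sub, HahnSeries.coeff_one]
    rcases (Int.lt_add_one_iff.mp hn : n ≤ 0).lt_or_eq with h | h
    · rw [hW.coeff_neg n h, if_neg h.ne, sub_zero]
    · rw [h, hW.coeff_zero, if_pos rfl, sub_self]
  have h2 : VanishesBelow 1 (2 * HahnSeries.C (W - 1)) := by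
    rw [two_mul]
    exact hW1.add hW1
  have hd := hW.vanishesBelow_shiftDiff
  have hWx := hW.vanishesBelow_pd_C 0
  have hVx : VanishesBelow 1 (pd 0 (shift (-2) W)) := by
    have h := (hd.pd 0).add hWx
    rwa [shiftDiff, map_sub, sub_add_cancel] at h
  refine VanishesBelow.sub (VanishesBelow.sub (VanishesBelow.sub (VanishesBelow.add ?_ ?_) ?_) ?_) ?_
  · exact (((hz.add hα).mul hz).mul hd).mono (by norm_num)
  · exact (hz.mul (hVx.add hWx)).mono (by norm_num)
  · exact (hμ.mul (hVx.sub hWx)).mono (by norm_num)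
  · exact ((hμ.mul hμ).mul (hW.vanishesBelow_shiftDiff_add hτ)).mono (by norm_num)
  · exact ((hμ.mul hα).mul (hd.add h2)).mono (by norm_num)

/-- The exchange relation times `z + μ`, for functions `f(μ) e` where `e` is an exponential. -/
theorem add_mul_exchange {B : Type*} [CommRing B] [Algebra ℚ B] [TimeAlgebra B]
    {φ : LaurentSeries A →+* B} (hφ : ∀ n x, φ (pd n x) = pd n (φ x)) {e : B}
    (he : ∀ n, pd n e = φ (spec A) ^ (2 * n + 1) * e) :
    (spec B + HahnSeries.C (φ (spec A))) * (pd 0 (shift (-2) (φ W * e)) +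
      HahnSeries.C (pd 0 (φ W * e)) + (spec B + laurentMap (φ.comp HahnSeries.C)
        (shiftDiff (logDer τ))) * (shift (-2) (φ W * e) - HahnSeries.C (φ W * e))) =
      laurentMap φ (exchangeDefect W τ) * HahnSeries.C e := by
  have hμ : ∀ n, pd n (φ (spec A)) = 0 := fun n => by rw [← hφ, pd_spec, map_zero]
  have hS := add_mul_shift_exp hμ he
  rw [shift_mul, shift_map hφ]
  set Z := spec B with hZ
  set m : LaurentSeries B := HahnSeries.C (φ (spec A)) with hm
  set E : LaurentSeries B := HahnSeries.C e with hE
  set w : LaurentSeries B := HahnSeries.C (φ W) with hw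
  set V := laurentMap φ (shift (-2) W) with hV
  set α := laurentMap (φ.comp HahnSeries.C) (shiftDiff (logDer τ)) with hα
  have hZ0 : pd 0 Z = 0 := pd_spec 0
  have hm0 : pd 0 m = 0 := by rw [hm, pd_C, hμ, map_zero]
  have hE0 : pd 0 E = m * E := by rw [hE, pd_C, he, mul_zero, zero_add, pow_one, map_mul]
  have hS' : (Z + m) * pd 0 (shift (-2) e) = (Z - m) * (m * E) := by
    have h := congrArg (pd 0 : Derivation ℚ (LaurentSeries B) _) hS
    simp only [Derivation.leibniz, map_add, map_sub, hZ0, hm0, hE0, smul_eq_mul] at h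
    linear_combination h
  have hψ : HahnSeries.C (pd 0 (φ W * e)) = pd 0 w * E + w * (m * E) := by
    rw [← pd_C, map_mul, Derivation.leibniz, hE0, smul_eq_mul, smul_eq_mul]
    ring
  have hVx : laurentMap φ (pd 0 (shift (-2) W)) = pd 0 V := laurentMap_pd hφ 0 _
  have hwx : laurentMap φ (pd 0 (HahnSeries.C W)) = pd 0 w := by
    rw [laurentMap_pd hφ, laurentMap_C]
  have hinv : m * HahnSeries.C (φ (HahnSeries.single 1 1)) = 1 := by
    rw [hm, ← map_mul, ← map_mul, spec, HahnSeries.single_mul_single, neg_add_cancel, one_mul,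
      HahnSeries.single_zero_one, map_one, map_one]
  have hα' : laurentMap φ (laurentMap HahnSeries.C (shiftDiff (logDer τ))) = α :=
    laurentMap_laurentMap _ _ _
  have hsd : laurentMap φ (shiftDiff W) = V - w := by rw [shiftDiff, map_sub, laurentMap_C]
  rw [exchangeDefect, hψ, Derivation.leibniz, smul_eq_mul, smul_eq_mul, map_mul]
  simp only [map_add, map_sub, map_mul, map_one, map_ofNat, hVx, hwx, hα', hsd, laurentMap_C,
    laurentMap_spec]
  rw [← hZ, ← hm, ← hw, ← hE]
  linear_combination V * hS' + (pd 0 V + (Z + α) * V) * hS + 2 * m * α * E * hinv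

/-- The difference of both sides of the exchange relation. -/
def exchangeError (W : PDO A) (τ : Aˣ) : LaurentSeries (BA A) :=
  pd 0 (shift (-2) (applyExp W)) + HahnSeries.C (pd 0 (applyExp W)) +
    (spec _ + laurentMap const (shiftDiff (logDer τ))) *
      (shift (-2) (applyExp W) - HahnSeries.C (applyExp W))

/-- The multipliers `z` and `Δ_z ∂ log τ` do not contain `μ`, and the span is stable under
multiplication by functions of `t` and under `∂`. -/
theorem coeff_exchangeError_mem (hW : IsDressing L W) (k : ℤ) :
    (exchangeError W τ).coeff k ∈ expSpan (waveSpan W) := by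
  have h1 := hW.coeff_shift_sub_mem (-2)
  have h2 : (HahnSeries.C (pd 0 (applyExp W)) : LaurentSeries (BA A)).coeff k ∈
      expSpan (waveSpan W) := by
    rw [HahnSeries.C_apply]
    by_cases hk : k = 0
    · rw [hk, HahnSeries.coeff_single_same]
      exact hW.pd_applyExp_mem 0
    · rw [HahnSeries.coeff_single_of_ne hk]
      exact zero_mem _
  have h3 : (pd 0 (shift (-2) (applyExp W))).coeff k ∈ expSpan (waveSpan W) := by
    have h := add_mem (hW.pd_mem_expSpan 0 (h1 k)) h2
    rwa [← coeff_pd, map_sub, HahnSeries.coeff_sub, pd_C, sub_add_cancel] at h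
  rw [exchangeError, add_mul, HahnSeries.coeff_add, HahnSeries.coeff_add, HahnSeries.coeff_add,
    coeff_spec_mul]
  refine add_mem (add_mem h3 h2) (add_mem (h1 _) ?_)
  obtain ⟨a, ha⟩ := PDO.exists_bound (laurentMap (const : A →+* BA A) (shiftDiff (logDer τ)))
  obtain ⟨b, hb⟩ := PDO.exists_bound (shift (-2) (applyExp W) - HahnSeries.C (applyExp W))
  rw [coeff_mul_eq_sum ha hb]
  exact sum_mem fun i _ => const_mul_mem_expSpan _ (h1 _)

theorem pd_T_one (n : ℕ) :
    pd n (T 1 : BA A) = (LaurentPolynomial.C (spec A)) ^ (2 * n + 1) * T 1 := by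
  have h := pd_applyExp n (1 : LaurentSeries A)
  rw [tsym_apply, Derivation.map_one_eq_zero, zero_add, mul_one, applyExp, applyExp, map_one,
    one_mul, map_pow] at h
  exact h

theorem add_mul_exchangeError : (spec (BA A) + HahnSeries.C (LaurentPolynomial.C (spec A))) *
    exchangeError W τ =
      laurentMap LaurentPolynomial.C (exchangeDefect W τ) * HahnSeries.C (T 1) :=
  add_mul_exchange C_pd pd_T_one

/-- If the coefficient of `z⁻ᵏ` vanishes, then multiplication by `z + μ` identifies the next one
with a coefficient of `exchangeDefect` times `e^{ξ(t,μ)}`. That series lies in `waveSpan W` and has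
no positive powers of `μ`, so it is zero. -/
theorem exchangeError_eq_zero (hW : IsDressing L W) (hτ : IsTau W τ) : exchangeError W τ = 0 := by
  refine coeff_eq_zero_of_recursion fun k hk => ?_
  have h := congrArg (fun f : LaurentSeries (BA A) => f.coeff k) (add_mul_exchangeError (W := W)
    (τ := τ))
  simp only [add_mul, HahnSeries.coeff_add, coeff_spec_mul, HahnSeries.C_mul_eq_smul,
    HahnSeries.coeff_smul, hk, smul_zero, add_zero] at h
  rw [mul_comm, HahnSeries.C_mul_eq_smul, HahnSeries.coeff_smul, coeff_laurentMap, smul_eq_mul,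
    mul_comm] at h
  obtain ⟨f, hf, hfk⟩ := coeff_exchangeError_mem (τ := τ) hW (k + 1)
  have h1 : f = (exchangeDefect W τ).coeff k := applyExp_injective (hfk.trans h)
  rw [← hfk, hW.eq_zero_of_mem_waveSpan hf, applyExp, map_zero, zero_mul]
  rw [h1]
  exact vanishesBelow_exchangeDefect hW hτ k

/-- The exchange relation between the wave function at `z` and the shift of a wave function by
`-2[z⁻¹]`. -/
theorem exchange (hW : IsDressing L W) (hτ : IsTau W τ) {B : Type*} [CommRing B] [Algebra ℚ B]
    [TimeAlgebra B] {φ : BA A →+* B} (hφ : ∀ n x, φ (pd n x) = pd n (φ x)) :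
    laurentMap (φ.comp const) W * (pd 0 (shift (-2) (φ (applyExp W))) +
      HahnSeries.C (pd 0 (φ (applyExp W)))) = dsym (laurentMap (φ.comp const) W) *
        (HahnSeries.C (φ (applyExp W)) - shift (-2) (φ (applyExp W))) := by
  have h := congrArg (laurentMap φ) (exchangeError_eq_zero hW hτ)
  have hc : ∀ n x, (φ.comp const) (pd n x) = pd n ((φ.comp const) x) := fun n x => by
    rw [RingHom.comp_apply, const_pd, hφ, RingHom.comp_apply]
  have hd : dsym (laurentMap (φ.comp const) W) =
      (spec B + laurentMap (φ.comp const) (shiftDiff (logDer τ))) *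
        laurentMap (φ.comp const) W := by
    have h := congrArg (laurentMap (φ.comp const)) hτ.dsym_eq
    rwa [dsym_apply, map_add, laurentMap_pd hc, map_mul, map_mul, map_add, laurentMap_spec] at h
  simp only [exchangeError, map_add, map_sub, map_mul, map_zero, laurentMap_pd hφ, ← shift_map hφ,
    laurentMap_C, laurentMap_spec, laurentMap_laurentMap, hφ] at h
  rw [hd]
  linear_combination laurentMap (φ.comp const) W * h

end Exchange

/-! ### Transfer from `ψ(t,μ)` to `ψ(t,-λ)` -/

section Reflection

variable {R S : Type*} [CommRing R] [CommRing S]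

/-- The homomorphism `BA R → BA S` induced by `R → S` and the substitution `λ ↦ -λ`. -/
def reflect (φ : R →+* S) : BA R →+* BA S :=
  LaurentPolynomial.eval₂ (LaurentPolynomial.C.comp (negSpecHom.comp (laurentMap φ)))
    (isUnit_T (-1)).unit

theorem reflect_C_mul_T (φ : R →+* S) (f : LaurentSeries R) (k : ℤ) :
    reflect φ (LaurentPolynomial.C f * T k) =
      LaurentPolynomial.C (negSpec (laurentMap φ f)) * T (-k) := by
  have h : (((isUnit_T (-1) : IsUnit (T (-1) : BA S)).unit ^ k : (BA S)ˣ) : BA S) = T (-k) := by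
    induction k using Int.induction_on with
    | zero => rw [zpow_zero, Units.val_one, neg_zero, T_zero]
    | succ k ih => rw [zpow_add_one, Units.val_mul, ih, IsUnit.unit_spec, ← T_add, neg_add]
    | pred k ih =>
      rw [zpow_sub_one, Units.val_mul, ih, Units.mul_inv_eq_iff_eq_mul, IsUnit.unit_spec, ← T_add]
      congr 1
      ring
  rw [reflect, eval₂_C_mul_T, h]
  rfl

theorem reflect_applyExp (φ : R →+* S) (f : LaurentSeries R) :
    reflect φ (applyExp f) = applyExpNeg (laurentMap φ f) :=
  reflect_C_mul_T φ f 1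

theorem reflect_const (φ : R →+* S) (a : R) : reflect φ (const a) = const (φ a) := by
  have h := reflect_C_mul_T φ (HahnSeries.C a) 0
  rwa [laurentMap_C, negSpec_C, neg_zero, T_zero, T_zero, mul_one, mul_one] at h

theorem reflect_comp_const (φ : R →+* S) : (reflect φ).comp const = const.comp φ :=
  RingHom.ext fun a => by rw [RingHom.comp_apply, RingHom.comp_apply, reflect_const]

theorem reflect_pd [Algebra ℚ R] [TimeAlgebra R] [Algebra ℚ S] [TimeAlgebra S] {φ : R →+* S}
    (hφ : ∀ n x, φ (pd n x) = pd n (φ x)) (n : ℕ) (x : BA R) :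
    reflect φ (pd n x) = pd n (reflect φ x) := by
  induction x using LaurentPolynomial.induction_on' with
  | add p q hp hq => simp only [map_add, hp, hq]
  | C_mul_T k f =>
    have h : negSpec (laurentMap φ (pd n f + k * spec R ^ (2 * n + 1) * f)) =
        pd n (negSpec (laurentMap φ f)) +
          (-k : ℤ) * spec S ^ (2 * n + 1) * negSpec (laurentMap φ f) := by
      rw [pd_negSpec, ← laurentMap_pd hφ, ← negSpecHom_apply, ← negSpecHom_apply]
      simp only [map_add, map_mul, map_pow, map_intCast, laurentMap_spec, negSpecHom_apply,
        negSpec_spec]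
      rw [Odd.neg_pow ⟨n, rfl⟩]
      push_cast
      ring
    rw [pd_C_mul_T, reflect_C_mul_T, reflect_C_mul_T, pd_C_mul_T, h]

end Reflection

/-- The functions `h(λ) e^{-ξ(t,λ)}`. -/
def expNegSpan (R : Type*) [CommRing R] [Algebra ℚ R] : Submodule ℚ (BA R) where
  carrier := {x | ∃ h : LaurentSeries R, LaurentPolynomial.C h * T (-1) = x}
  add_mem' := by
    rintro _ _ ⟨f, rfl⟩ ⟨g, rfl⟩
    exact ⟨f + g, by rw [map_add, add_mul]⟩
  zero_mem' := ⟨0, by simp⟩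
  smul_mem' := by
    rintro q _ ⟨f, rfl⟩
    refine ⟨HahnSeries.C (algebraMap ℚ R q) * f, ?_⟩
    rw [Algebra.smul_def, algebraMap_BA, const_apply, map_mul, mul_assoc]

theorem C_mul_mem_expNegSpan {R : Type*} [CommRing R] [Algebra ℚ R] (a : LaurentSeries R)
    {x : BA R} (hx : x ∈ expNegSpan R) :
    LaurentPolynomial.C a * x ∈ expNegSpan R := by
  obtain ⟨f, rfl⟩ := hx
  exact ⟨a * f, by rw [map_mul, mul_assoc]⟩

/-! ### The bilinear potential, the three-term relation and the operator `Y` -/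

section Vertex

variable {R : Type*} [CommRing R] [Algebra ℚ R] [TimeAlgebra R]

theorem pd_applyExpNeg (n : ℕ) (f : LaurentSeries R) : pd n (applyExpNeg f) =
    LaurentPolynomial.C (pd n (negSpec f) - spec R ^ (2 * n + 1) * negSpec f) * T (-1) := by
  rw [applyExpNeg, pd_C_mul_T]
  push_cast
  congr 2
  ring

theorem shift_two (f : R) : shift 2 f = negSpec (shift (-2) f) := by
  rw [← shift_neg, neg_neg]

/-- The time derivative of the bilinear function `ψ(t,-λ) φ(t + 2[λ⁻¹])`. -/
theorem pd_bilinear {w : LaurentSeries R} {ψ : R}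
    (h : w * (pd 0 (shift (-2) ψ) + HahnSeries.C (pd 0 ψ)) =
      dsym w * (HahnSeries.C ψ - shift (-2) ψ)) :
    pd 0 (LaurentPolynomial.C (shift 2 ψ) * applyExpNeg w) =
      pd 0 (applyExpNeg w) * const ψ - applyExpNeg w * pd 0 (const ψ : BA R) := by
  -- The exchange relation at `z = -λ`: the shift becomes `t ↦ t + 2[λ⁻¹]`, and `w` becomes the
  -- series of `ψ(t,-λ)`.
  have h1 := congrArg negSpecHom h
  simp only [map_mul, map_add, map_sub, dsym_apply, negSpecHom_apply, negSpec_C, negSpec_spec,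
    ← pd_negSpec, ← shift_two] at h1
  have h2 : LaurentPolynomial.C (shift 2 ψ) * applyExpNeg w =
      LaurentPolynomial.C (shift 2 ψ * negSpec w) * T (-1) := by
    rw [applyExpNeg, map_mul, mul_assoc]
  rw [h2, pd_C_mul_T, pd_applyExpNeg, applyExpNeg, ← const_pd, const_apply, const_apply,
    mul_zero, zero_add, pow_one, Derivation.leibniz, smul_eq_mul, smul_eq_mul]
  have h3 : ∀ x y a b : LaurentSeries R, (LaurentPolynomial.C x * T (-1) * LaurentPolynomial.C a -
      LaurentPolynomial.C y * T (-1) * LaurentPolynomial.C b : BA R) =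
        LaurentPolynomial.C (x * a - y * b) * T (-1) := fun x y a b => by
    rw [map_sub, map_mul, map_mul]
    ring
  rw [h3]
  congr 2
  push_cast
  linear_combination h1

/-- Two solutions `f`, `g` of the exchange relation and their bilinear potential `Q` satisfy the
three-term relation up to a function that does not depend on `x`. -/
theorem pd_three_term {w w' : LaurentSeries R} (hw : w * w' = 1) {f g Q : R}
    (hf : w * (pd 0 (shift (-2) f) + HahnSeries.C (pd 0 f)) =
      dsym w * (HahnSeries.C f - shift (-2) f))
    (hg : w * (pd 0 (shift (-2) g) + HahnSeries.C (pd 0 g)) =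
      dsym w * (HahnSeries.C g - shift (-2) g))
    (hQ : pd 0 Q = pd 0 f * g - f * pd 0 g) :
    pd 0 (shiftDiff Q - (HahnSeries.C g * shift (-2) f - HahnSeries.C f * shift (-2) g)) = 0 := by
  have hS : pd 0 (shift (-2) Q) = pd 0 (shift (-2) f) * shift (-2) g -
      shift (-2) f * pd 0 (shift (-2) g) := by
    rw [← shift_pd, hQ, ← shiftHom_apply, map_sub, map_mul, map_mul]
    simp only [shiftHom_apply, shift_pd]
  have hC : pd 0 (HahnSeries.C Q : LaurentSeries R) =
      HahnSeries.C (pd 0 f) * HahnSeries.C g - HahnSeries.C f * HahnSeries.C (pd 0 g) := by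
    rw [pd_C, hQ, map_sub, map_mul, map_mul]
  have h : w * pd 0 (shiftDiff Q - (HahnSeries.C g * shift (-2) f - HahnSeries.C f * shift (-2) g))
      = 0 := by
    simp only [shiftDiff, map_sub, Derivation.leibniz, smul_eq_mul, hS, hC]
    simp only [pd_C]
    linear_combination (shift (-2) g - HahnSeries.C g) * hf - (shift (-2) f - HahnSeries.C f) * hg
  -- The computation has been made after multiplication by `w`, which is invertible.
  linear_combination w' * h - pd 0 (shiftDiff Q -
    (HahnSeries.C g * shift (-2) f - HahnSeries.C f * shift (-2) g)) * hw

theorem pd_mem_expNegSpan (n : ℕ) {x : BA R} (hx : x ∈ expNegSpan R) :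
    pd n x ∈ expNegSpan R := by
  obtain ⟨f, rfl⟩ := hx
  exact ⟨_, (pd_C_mul_T n f (-1)).symm⟩

/-- On such functions `∂` acts by `h ↦ h_x - λh`, which is `dsym` conjugated by `λ ↦ -λ`, hence
injective. -/
theorem eq_zero_of_mem_expNegSpan {x : BA R} (hx : x ∈ expNegSpan R) (h : pd 0 x = 0) : x = 0 := by
  obtain ⟨f, rfl⟩ := hx
  have hz : negSpec (0 : LaurentSeries R) = 0 := map_zero negSpecHom
  have h1 : applyExp (negSpec (dsym (negSpec f))) = applyExp 0 := by
    rw [applyExp, applyExp, map_zero, zero_mul, show (1 : ℤ) = -1 + 2 by norm_num, T_add,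
      ← mul_assoc, dsym_apply, negSpec_add, ← pd_negSpec, negSpec_negSpec, negSpec_mul,
      negSpec_negSpec, negSpec_spec]
    rw [pd_C_mul_T, mul_zero, zero_add, pow_one] at h
    push_cast at h
    rw [neg_one_mul] at h
    rw [h, zero_mul]
  have h2 := congrArg negSpec (applyExp_injective h1)
  rw [negSpec_negSpec, hz] at h2
  have h3 := congrArg negSpec (dsym_injective (h2.trans (map_zero dsym).symm))
  rw [negSpec_negSpec, hz] at h3
  rw [h3, map_zero, zero_mul]

theorem coeff_shift_mem_expNegSpan (c : ℚ) {x : BA R} (hx : x ∈ expNegSpan R) (k : ℤ) :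
    (shift c x).coeff k ∈ expNegSpan R := by
  by_cases hk : k = 0
  · rwa [hk, coeff_zero_shift]
  · refine (isFlow_shift c x).coeff_mem (fun n => ?_) (fun n y hy => pd_mem_expNegSpan n hy) hk
    rw [coeff_zero_shift]
    exact pd_mem_expNegSpan n hx

/-- The three-term relation between `f = ψ(t,-λ)`, a function `ψ` that does not contain `λ`, and
their bilinear potential `f ψ(t + 2[λ⁻¹])`. -/
theorem three_term {w₀ : LaurentSeries R} {ψ : R}
    (h₀ : w₀ * (pd 0 (shift (-2) ψ) + HahnSeries.C (pd 0 ψ)) =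
      dsym w₀ * (HahnSeries.C ψ - shift (-2) ψ)) {w w' : LaurentSeries (BA R)} (hw : w * w' = 1)
    (hf : w * (pd 0 (shift (-2) (applyExpNeg w₀)) + HahnSeries.C (pd 0 (applyExpNeg w₀))) =
      dsym w * (HahnSeries.C (applyExpNeg w₀) - shift (-2) (applyExpNeg w₀)))
    (hg : w * (pd 0 (shift (-2) (const ψ)) + HahnSeries.C (pd 0 (const ψ))) =
      dsym w * (HahnSeries.C (const ψ) - shift (-2) (const ψ))) :
    shiftDiff (LaurentPolynomial.C (shift 2 ψ) * applyExpNeg w₀) =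
      HahnSeries.C (const ψ) * shift (-2) (applyExpNeg w₀) -
        HahnSeries.C (applyExpNeg w₀) * shift (-2) (const ψ) := by
  have h := pd_three_term hw hf hg (pd_bilinear h₀)
  have hfm : applyExpNeg w₀ ∈ expNegSpan R := ⟨_, rfl⟩
  have hQ := C_mul_mem_expNegSpan (shift 2 ψ) hfm
  rw [← sub_eq_zero]
  refine HahnSeries.ext (funext fun k => ?_)
  rw [HahnSeries.coeff_zero]
  -- No integration constant can appear: each coefficient in `z` is a series in `λ` times
  -- `e^{-ξ(t,λ)}`, because shifts and multiplication by functions without `λ` preserve this form.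
  refine eq_zero_of_mem_expNegSpan (R := R) ?_ ?_
  · rw [shiftDiff, HahnSeries.coeff_sub, HahnSeries.coeff_sub, HahnSeries.coeff_sub,
      HahnSeries.C_mul_eq_smul, HahnSeries.C_mul_eq_smul, HahnSeries.coeff_smul,
      HahnSeries.coeff_smul, shift_map const_pd, coeff_laurentMap, smul_eq_mul, smul_eq_mul,
      mul_comm (applyExpNeg w₀) (const _)]
    refine sub_mem (sub_mem (coeff_shift_mem_expNegSpan _ hQ k) ?_) (sub_mem
      (C_mul_mem_expNegSpan _ (coeff_shift_mem_expNegSpan _ hfm k)) (C_mul_mem_expNegSpan _ hfm))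
    rw [HahnSeries.C_apply]
    by_cases hk : k = 0
    · rw [hk, HahnSeries.coeff_single_same]
      exact hQ
    · rw [HahnSeries.coeff_single_of_ne hk]
      exact zero_mem _
  · exact congrArg (fun F : LaurentSeries (BA R) => F.coeff k) h

/-- The function `∂⁻¹(g_x ψ(t,z))` for a solution `g` of the exchange relation. -/
theorem two_mul_derComp_neg_one {w : LaurentSeries R} {g : R}
    (hg : w * (pd 0 (shift (-2) g) + HahnSeries.C (pd 0 g)) =
      dsym w * (HahnSeries.C g - shift (-2) g)) :
    2 * PDO.derComp (-1) (HahnSeries.C (pd 0 g) * w) =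
      HahnSeries.C g * w - shift (-2) g * w := by
  -- After applying `∂` the left side is `2 g_x ψ(t,z)`, and the exchange relation gives the same
  -- for the right side.
  apply dsym_injective
  rw [two_mul, map_add, map_sub, PDO.dsym_derComp, neg_add_cancel, PDO.derComp_zero, dsym_mul,
    dsym_mul, pd_C]
  linear_combination hg

theorem inducedVariation_eq (τ : Rˣ) (δ : R) : inducedVariation τ δ =
    applyExp (shift (-2) (τ : R) * HahnSeries.C (↑τ⁻¹ : R)) *
      LaurentPolynomial.C (shiftDiff (δ * (↑τ⁻¹ : R))) := by
  have h1 : shift (-2) (τ : R) * shift (-2) (↑τ⁻¹ : R) = 1 := by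
    rw [← shift_mul, τ.mul_inv, shift_one]
  have h2 : (HahnSeries.C (τ : R) : LaurentSeries R) * HahnSeries.C (↑τ⁻¹ : R) = 1 := by
    rw [← map_mul, τ.mul_inv, map_one]
  rw [inducedVariation, applyExp, mul_right_comm, ← map_mul]
  congr 2
  rw [shiftDiff, shift_mul, map_mul]
  linear_combination shift (-2) δ * HahnSeries.C (↑τ⁻¹ : R) * h2 -
    shift (-2) δ * HahnSeries.C (↑τ⁻¹ : R) * h1

theorem comp_sandwich (f g : R) (Q : PDO R) :
    PDO.comp (PDO.comp (PDO.comp (PDO.mulBy f) (PDO.der R (-1))) (PDO.mulBy g)) Q =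
      HahnSeries.C f * PDO.derComp (-1) (HahnSeries.C g * Q) := by
  rw [PDO.comp_assoc, PDO.comp_assoc, PDO.mulBy_comp, PDO.mulBy_comp]

/-- The action of the operator `f ∂⁻¹ g_x - g ∂⁻¹ f_x` on the wave function. -/
theorem two_mul_applyExp_comp {w : LaurentSeries R} {f g : R}
    (hf : w * (pd 0 (shift (-2) f) + HahnSeries.C (pd 0 f)) =
      dsym w * (HahnSeries.C f - shift (-2) f))
    (hg : w * (pd 0 (shift (-2) g) + HahnSeries.C (pd 0 g)) =
      dsym w * (HahnSeries.C g - shift (-2) g)) :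
    2 * applyExp (PDO.comp
      (PDO.comp (PDO.comp (PDO.mulBy f) (PDO.der R (-1))) (PDO.mulBy (pd 0 g)) -
        PDO.comp (PDO.comp (PDO.mulBy g) (PDO.der R (-1))) (PDO.mulBy (pd 0 f))) w) =
      applyExp w * LaurentPolynomial.C
        (HahnSeries.C g * shift (-2) f - HahnSeries.C f * shift (-2) g) := by
  rw [PDO.comp_sub_left, comp_sandwich, comp_sandwich, applyExp, applyExp, mul_right_comm,
    ← map_mul, ← mul_assoc, ← map_ofNat LaurentPolynomial.C 2, ← map_mul]
  congr 2
  linear_combination HahnSeries.C f * two_mul_derComp_neg_one hg -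
    HahnSeries.C g * two_mul_derComp_neg_one hf

end Vertex

/-! ### Assembly: the vertex operator acting on `τ` and on the wave function -/

section Main

variable {A : Type*} [CommRing A] [Algebra ℚ A] [TimeAlgebra A] {L W : PDO A} {τ : Aˣ}

theorem toFun2_pd (n : ℕ) (a : A) : (toFun2 (pd n a) : Fun2 A) = pd n (toFun2 a) := by
  rw [toFun2, RingHom.comp_apply, RingHom.comp_apply, const_pd, const_pd]

theorem IsTau.laurentMap_eq (hτ : IsTau W τ) {R : Type*} [CommRing R] [Algebra ℚ R] [TimeAlgebra R]
    {φ : A →+* R} (hφ : ∀ n x, φ (pd n x) = pd n (φ x)) : laurentMap φ W =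
      shift (-2) (φ (τ : A)) * HahnSeries.C (φ (↑τ⁻¹ : A)) := by
  rw [hτ, map_mul, laurentMap_C, shift_map hφ]

theorem IsTau.exists_inverse (hτ : IsTau W τ) {R : Type*} [CommRing R] (φ : A →+* R) :
    ∃ w', laurentMap φ W * w' = 1 := by
  refine ⟨laurentMap φ (shift (-2) (↑τ⁻¹ : A) * HahnSeries.C (τ : A)), ?_⟩
  rw [← map_mul, hτ, mul_mul_mul_comm, ← shift_mul, ← map_mul, τ.mul_inv, τ.inv_mul, shift_one,
    map_one, one_mul, map_one]

/-- Dividing and multiplying by `τ(t + 2[λ⁻¹])` splits `𝒳τ/τ` into the shifted `ψ(t,μ)` and `ψ(t,-λ)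
= τ(t + 2[λ⁻¹])/τ(t) · e^{-ξ(t,λ)}`. -/
theorem vertexOp_mul (hτ : IsTau W τ) : vertexOp (τ : A) * toFun2 (↑τ⁻¹ : A) =
    LaurentPolynomial.C (shift 2 (applyExp W)) * psiNegLambda W := by
  have hψ : applyExp W = LaurentPolynomial.C (shift (-2) (τ : A)) * const (↑τ⁻¹ : A) * T 1 := by
    rw [applyExp, hτ, map_mul, const_apply]
  have hf : psiNegLambda W = LaurentPolynomial.C (shift 2 (const (τ : A) : BA A) *
      HahnSeries.C (const (↑τ⁻¹ : A))) * T (-1) := by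
    rw [psiNegLambda, ← laurentMap_apply, hτ.laurentMap_eq const_pd, applyExpNeg, negSpec_mul,
      negSpec_C, ← shift_two]
  have h1 : shift 2 (const (τ : A) : BA A) * shift 2 (const (↑τ⁻¹ : A) : BA A) = 1 := by
    rw [← shift_mul, ← map_mul, τ.mul_inv, map_one, shift_one]
  rw [hψ, hf, vertexOp, toFun2, RingHom.comp_apply, const_apply (const (↑τ⁻¹ : A) : BA A),
    shift_mul, shift_mul]
  have h2 := congrArg (LaurentPolynomial.C : LaurentSeries (BA A) →+* Fun2 A) h1
  rw [map_mul, map_one] at h2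
  simp only [map_mul]
  rw [← mul_one (LaurentPolynomial.C (shift 2 (T 1 : BA A)) * T (-1)), ← h2]
  ring

theorem vertexPsi_eq (hτ : IsTau W τ) : vertexPsi τ = psiZ W * LaurentPolynomial.C
    (shiftDiff (vertexOp (τ : A) * toFun2 (↑τ⁻¹ : A))) := by
  rw [vertexPsi, inducedVariation_eq, psiZ, lift2, ← laurentMap_apply,
    hτ.laurentMap_eq toFun2_pd]
  rfl

theorem exchange_inner (hW : IsDressing L W) (hτ : IsTau W τ) :
    laurentMap const W * (pd 0 (shift (-2) (applyExp W)) + HahnSeries.C (pd 0 (applyExp W))) =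
      dsym (laurentMap const W) * (HahnSeries.C (applyExp W) - shift (-2) (applyExp W)) := by
  have h := exchange hW hτ (φ := RingHom.id (BA A)) fun n x => by
    rw [RingHom.id_apply, RingHom.id_apply]
  simpa only [RingHom.id_comp, RingHom.id_apply] using h

theorem exchange_psiMu (hW : IsDressing L W) (hτ : IsTau W τ) :
    lift2 W * (pd 0 (shift (-2) (psiMu W)) + HahnSeries.C (pd 0 (psiMu W))) =
      dsym (lift2 W) * (HahnSeries.C (psiMu W) - shift (-2) (psiMu W)) :=
  exchange hW hτ const_pd

theorem exchange_psiNegLambda (hW : IsDressing L W) (hτ : IsTau W τ) :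
    lift2 W * (pd 0 (shift (-2) (psiNegLambda W)) + HahnSeries.C (pd 0 (psiNegLambda W))) =
      dsym (lift2 W) * (HahnSeries.C (psiNegLambda W) - shift (-2) (psiNegLambda W)) := by
  -- The reflection sends `ψ(t,μ)` to `ψ(t,-λ)` and commutes with all time derivatives, so the
  -- relation for `μ` carries over.
  have h := exchange hW hτ (φ := reflect (const : A →+* BA A)) (reflect_pd const_pd)
  rw [reflect_comp_const, reflect_applyExp] at h
  exact h

theorem shiftDiff_vertexOp (hW : IsDressing L W) (hτ : IsTau W τ) :
    shiftDiff (vertexOp (τ : A) * toFun2 (↑τ⁻¹ : A)) =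
      HahnSeries.C (psiMu W) * shift (-2) (psiNegLambda W) -
        HahnSeries.C (psiNegLambda W) * shift (-2) (psiMu W) := by
  obtain ⟨w', hw'⟩ := hτ.exists_inverse (toFun2 : A →+* Fun2 A)
  rw [vertexOp_mul hτ]
  exact three_term (exchange_inner hW hτ) hw' (exchange_psiNegLambda hW hτ) (exchange_psiMu hW hτ)

end Main

end BKP

end

theorem mainTheorem4 {A : Type*} [CommRing A] [Algebra ℚ A] [BKP.TimeAlgebra A]
    (L W : BKP.PDO A) (τ : Aˣ) (hW : BKP.IsDressing L W) (hτ : BKP.IsTau W τ) :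
    BKP.vertexPsi τ =
        BKP.psiZ W * LaurentPolynomial.C
          (BKP.shiftDiff (BKP.vertexOp (τ : A) * BKP.toFun2 (↑τ⁻¹ : A))) ∧
      BKP.vertexPsi τ = 2 * BKP.opYPsi W := by
  refine ⟨BKP.vertexPsi_eq hτ, (BKP.vertexPsi_eq hτ).trans ?_⟩
  rw [BKP.shiftDiff_vertexOp hW hτ]
  exact (BKP.two_mul_applyExp_comp (BKP.exchange_psiNegLambda hW hτ)
    (BKP.exchange_psiMu hW hτ)).symm
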